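/- **Construction.** Fix an integer $D\ge 1$. Let $T_0$ be a single node, and for $1\le d\le D$ let $T_d$ be the rooted tree whose root has, for every $d'\in\{0,\dots,d-1\}$, exactly $2^{D-d'}$ child subtrees that are copies of $T_{d'}$. The tree $T_D$ is the instance. **Models.** In *online graph balancing* on a tree with $n$ nodes, the nodes carry distinct names from $\{1,\dots,n\}$. The edges are revealed one at a time, each as an unordered pair of names, and each edge must be oriented immediately and irrevocably towards one of its endpoints, depending only on the edges revealed so far and on the internal randomness of the algorithm. The algorithm may depend on $D$, hence may know the unnamed tree. The *maximum load* is the maximum in-degree of the resulting orientation. In *online load balancing on $m$ unrelated machines*, an instance consists of finitely many jobs $j$ with sizes $p_{i,j}\in(0,\infty]$ on the machines $i$. The jobs arrive in uniformly random order. The algorithm knows the number of jobs in advance and must irrevocably assign each job on arrival to one machine, knowing the size vectors of the jobs that have arrived so far. The makespan is the largest total size assigned to a machine. The *competitive ratio* of a randomized algorithm is the supremum, over all instances whose optimal offline makespan is positive and finite, of the expected makespan (over the arrival order and the internal randomness) divided by the optimal offline makespan. **Theorem.** There is an absolute constant $c>0$ such that the following hold. 1. For every integer $D\ge 1$, $T_D$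 is a tree of height $D$ (the largest distance from the root to a node is $D$); its number $n$ of nodes satisfies $n\le 4^{D^2}$, and $D\ge c\sqrt{\log n}$; and the minimum over all orientations of $T_D$ of the maximum in-degree is $1$. Moreover, for every (possibly randomized) online orientation algorithm: * if the nodes are named uniformly at random and, independently, the edges arrive in uniformly random order, then with probability at least $1-\frac1n$ (over names, arrival order and internal randomness) the maximum load is at least $c\sqrt{\log n}$; * there is a fixed naming of the nodes for which, when the edges arrive in uniformly random order, the maximum load is at least $c\sqrt{\log n}$ with probability at least $1-\frac1n$ (over arrival order and internal randomness), and the expected maximum load is at least $c\sqrt{\log n}$. 2. For every $m\ge 1$, every (possibly randomized) online algorithm for load balancing on $m$ unrelated machines has competitive ratio at least $c\sqrt{\log m}$ in the random-order model. -/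

import Mathlib

open MeasureTheory
open scoped ENNReal

/-! ### The recursive tree -/

/-- The nodes of the rooted tree `T_d` (`d ≤ D`) in the construction with parameter `D`: a root and,
for every `d' < d`, the nodes of `2 ^ (D - d')` disjoint copies of `T_{d'}`. -/
inductive HardNode (D : ℕ) : ℕ → Type
  | root (d : ℕ) : HardNode D d
  | sub {d : ℕ} (d' : Fin d) (i : Fin (2 ^ (D - (d' : ℕ)))) (x : HardNode D d') : HardNode D d

/-- `IsChild x y`: the node `y` is a child of the node `x`. The root of `T_d` has as its children the
roots of all the copies; inside a copy the relation is the one of the copy. -/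
inductive HardNode.IsChild {D : ℕ} : {d : ℕ} → HardNode D d → HardNode D d → Prop
  | root {d : ℕ} (d' : Fin d) (i : Fin (2 ^ (D - (d' : ℕ)))) :
      HardNode.IsChild (HardNode.root d) (HardNode.sub d' i (HardNode.root d'))
  | sub {d : ℕ} (d' : Fin d) (i : Fin (2 ^ (D - (d' : ℕ)))) {x y : HardNode D d'} :
      HardNode.IsChild x y → HardNode.IsChild (HardNode.sub d' i x) (HardNode.sub d' i y)

/-- The tree `T_D`, as an undirected graph. -/
def hardTree (D : ℕ) : SimpleGraph (HardNode D D) :=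
  SimpleGraph.fromRel HardNode.IsChild

theorem HardNode.finite (D d : ℕ) : Finite (HardNode D d) := by
  induction d using Nat.strong_induction_on with
  | _ d ih =>
    have : ∀ d' : Fin d, Finite (HardNode D d') := fun d' => ih d' d'.2
    refine Finite.of_surjective
      (fun o : Option (Σ d' : Fin d, Fin (2 ^ (D - (d' : ℕ))) × HardNode D d') =>
        match o with
        | none => HardNode.root d
        | some ⟨d', i, x⟩ => HardNode.sub d' i x) ?_
    intro y
    cases y with
    | root => exact ⟨none, rfl⟩
    | sub d' i x => exact ⟨some ⟨d', i, x⟩, rfl⟩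

instance (D d : ℕ) : Finite (HardNode D d) := HardNode.finite D d

/-- The number of nodes of `T_D`. -/
noncomputable def hardSize (D : ℕ) : ℕ := Nat.card (HardNode D D)

/-! ### Uniform averages -/

/-- The expectation of `f a` for `a` uniformly distributed on the finite nonempty type `α`. -/
noncomputable def unifExp {α : Type*} [Finite α] (f : α → ℝ≥0∞) : ℝ≥0∞ :=
  (∑' a, f a) / (Nat.card α : ℝ≥0∞)

/-! ### Graph balancing -/

/-- The maximum, over all vertices `v`, of the number of indices (edges) whose head is `v`. -/
noncomputable def maxInDegree {ι V : Type*} [Finite ι] [Finite V] (head : ι → V) : ℕ :=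
  ⨆ v : V, {t : ι | head t = v}.ncard

/-- The maximum in-degrees of all the (offline) orientations of `G`. The offline optimum is the least
element of this set. -/
def orientationLoads {V : Type*} [Finite V] (G : SimpleGraph V) : Set ℕ :=
  {L | ∃ head : G.edgeSet → V, (∀ e : G.edgeSet, head e ∈ e.1) ∧ maxInDegree head = L}

/-- A deterministic online orientation algorithm on the vertex set `X`: given the list of the edges
that arrived earlier and the edge that arrives now, it chooses the endpoint towards which the new edge
is oriented. (Its own earlier decisions are determined by the list of earlier edges.) -/
structure OnlineOrienter (X : Type*) where
  orient : List (Sym2 X) → Sym2 X → X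
  orient_mem : ∀ h e, orient h e ∈ e

/-- The heads chosen by the algorithm when the edges arrive as `edges 0, edges 1, …`. -/
def OnlineOrienter.run {X : Type*} (A : OnlineOrienter X) {k : ℕ} (edges : Fin k → Sym2 X) :
    Fin k → X :=
  fun t => A.orient ((List.ofFn edges).take t) (edges t)

/-- The naming of the nodes of `T_D` by the identities that the algorithm sees. -/
abbrev Naming (D : ℕ) : Type := HardNode D D ≃ Fin (hardSize D)

/-- The arrival orders of the edges of `T_D`. -/
abbrev ArrivalOrder (D : ℕ) : Type := Fin (Nat.card (hardTree D).edgeSet) ≃ (hardTree D).edgeSet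

/-- The edge revealed at time `t`: the unordered pair of the names of the endpoints. -/
def revealed {D : ℕ} (ψ : Naming D) (π : ArrivalOrder D) (t : Fin (Nat.card (hardTree D).edgeSet)) :
    Sym2 (Fin (hardSize D)) :=
  Sym2.map ψ (π t : Sym2 (HardNode D D))

/-- The maximum load of the orientation of `T_D` produced by the algorithm, when the nodes are named
by `ψ` and the edges arrive in the order `π`. -/
noncomputable def onlineLoad {D : ℕ} (A : OnlineOrienter (Fin (hardSize D))) (ψ : Naming D)
    (π : ArrivalOrder D) : ℕ :=
  maxInDegree (A.run (revealed ψ π))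

/-! ### Load balancing on unrelated machines -/

/-- The makespan of the assignment `σ` of the jobs `Fin N` to the machines `Fin m`, where job `j` has
size `p j i` on machine `i`. -/
noncomputable def makespan {N m : ℕ} (p : Fin N → Fin m → ℝ≥0∞) (σ : Fin N → Fin m) : ℝ≥0∞ :=
  ⨆ i : Fin m, ∑ j : Fin N, if σ j = i then p j i else 0

/-- The offline optimal makespan. -/
noncomputable def optMakespan {N m : ℕ} (p : Fin N → Fin m → ℝ≥0∞) : ℝ≥0∞ :=
  ⨅ σ : Fin N → Fin m, makespan p σ

/-- A deterministic online scheduling algorithm for `m` machines: given the total number of jobs, the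
list of the size vectors of the jobs that arrived earlier and the size vector of the current job, it
chooses the machine of the current job. -/
abbrev OnlineScheduler (m : ℕ) : Type :=
  ℕ → List (Fin m → ℝ≥0∞) → (Fin m → ℝ≥0∞) → Fin m

/-- The assignment produced by the algorithm on the jobs arriving as `q 0, q 1, …`. -/
def OnlineScheduler.run {m : ℕ} (A : OnlineScheduler m) {N : ℕ} (q : Fin N → Fin m → ℝ≥0∞) :
    Fin N → Fin m :=
  fun t => A N ((List.ofFn q).take t) (q t)

/-- The expected makespan, on the instance `p` in uniformly random order, of the randomized algorithm
that draws `ω` from `P` and runs `A ω`. -/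
noncomputable def expectedMakespan {Ω : Type*} [MeasurableSpace Ω] (P : Measure Ω) {m : ℕ}
    (A : Ω → OnlineScheduler m) {N : ℕ} (p : Fin N → Fin m → ℝ≥0∞) : ℝ≥0∞ :=
  ∫⁻ ω, unifExp (fun π : Equiv.Perm (Fin N) =>
    makespan (fun t => p (π t)) ((A ω).run fun t => p (π t))) ∂P

/-- The competitive ratio in the random-order model of a randomized algorithm for `m` machines: the
supremum of the ratio of the expected makespan to the optimal makespan, over all instances with sizes
in `(0, ∞]` whose optimal makespan is positive and finite. -/
noncomputable def competitiveRatio {Ω : Type*} [MeasurableSpace Ω] (P : Measure Ω) {m : ℕ}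
    (A : Ω → OnlineScheduler m) : ℝ≥0∞ :=
  ⨆ (N : ℕ) (p : Fin N → Fin m → ℝ≥0∞)
    (_ : (∀ j i, p j i ≠ 0) ∧ optMakespan p ≠ 0 ∧ optMakespan p ≠ ⊤),
    expectedMakespan P A p / optMakespan p

/-!
Fix a deterministic orientation algorithm, let `d = D / 2`, and call the roots of the `2 ^ (D - d)`
copies of `T_d` directly below the root of `T_D` *hubs*. The proof shows that, outside an event of
probability at most `1 / n`, some hub receives at least `d / 8` edges from its own children.

Consider a hub `u` and a level `d' < d`, and the star of the edges from `u` to its parent and to its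
children of level at least `d'`. At least half of these edges lead to children of level `d'`, so with
probability at least `1 / 2` the first one to arrive does (`card_starOther_le`, `sum_isFirst_le`).
Let `v` be that child. When the edge `uv` arrives, the hub `u` together with its child subtrees of
level less than `d'` is a copy of `T_{d'}`, just as the subtree of `v` is, and nothing that has arrived
so far tells the two apart. Formally, exchanging these two copies is an involution on pairs of a naming
and an arrival order (`exchange`, `exchange_involutive`) that preserves everything revealed up to the
arrival of `uv` (`revealed_exchange_congr`), whereas it flips whether the algorithm orients this edge
towards the hub (`isHit_exchange_iff_not`).

The exchanges at different hubs commute. Performing them according to a vector of random bits, the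
directions of the first edges are a triangular function of the bits with respect to the arrival order,
hence again independent and uniform (`bijective_of_triangular`, `sum_isHit_le`). For every level `d'`,
therefore, the number of hubs whose first edge leads to a child of level `d'` and is oriented towards the
hub is at least one eighth of the number of hubs, except with a probability that is doubly exponentially
small in `D` (`card_few_hits_le`). A union bound over the levels and an averaging over the hubs give the
hub of large load (`le_onlineLoad_of_many_hits`, `ncard_small_load_le`).

Randomized algorithms are handled by averaging over their randomness, and the fixed naming by averaging
over the namings (`exists_naming`). For unrelated machines, the edges of the largest tree with at most
`m` nodes become jobs that can only be scheduled on the two machines named by their endpoints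
(`ofReal_le_competitiveRatio`).
-/

/-! ### Swapping along two disjoint embeddings -/

open Classical in
/-- The map that exchanges `w a` and `g a` for every `a` and fixes all other points. It is meant for
injective `w` and `g` with disjoint ranges. -/
noncomputable def swapFun {A X : Type*} (w g : A → X) (x : X) : X :=
  if h : ∃ a, w a = x then g h.choose else if h : ∃ a, g a = x then w h.choose else x

section Swap

variable {A X : Type*} {w g : A → X}

theorem swapFun_left (hw : w.Injective) (a : A) : swapFun w g (w a) = g a := by
  have h : ∃ b, w b = w a := ⟨a, rfl⟩
  rw [swapFun, dif_pos h, hw h.choose_spec]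

theorem swapFun_right (hg : g.Injective) (hwg : ∀ a b, w a ≠ g b) (a : A) :
    swapFun w g (g a) = w a := by
  have h : ∃ b, g b = g a := ⟨a, rfl⟩
  rw [swapFun, dif_neg (fun ⟨b, hb⟩ => hwg b a hb), dif_pos h, hg h.choose_spec]

theorem swapFun_of_notMem {x : X} (hw : ∀ a, w a ≠ x) (hg : ∀ a, g a ≠ x) :
    swapFun w g x = x := by
  rw [swapFun, dif_neg (fun ⟨b, hb⟩ => hw b hb), dif_neg (fun ⟨b, hb⟩ => hg b hb)]

theorem swapFun_involutive (hw : w.Injective) (hg : g.Injective) (hwg : ∀ a b, w a ≠ g b) :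
    Function.Involutive (swapFun w g) := by
  intro x
  by_cases h : ∃ a, w a = x
  · obtain ⟨a, rfl⟩ := h
    rw [swapFun_left hw, swapFun_right hg hwg]
  by_cases h' : ∃ a, g a = x
  · obtain ⟨a, rfl⟩ := h'
    rw [swapFun_right hg hwg, swapFun_left hw]
  · push Not at h h'
    rw [swapFun_of_notMem h h', swapFun_of_notMem h h']

end Swap

/-! ### Averaging over random bits -/

/-- If the average of `f` along a family of bijections is at most `g` pointwise, then the sum of `f`
is at most the sum of `g`. -/
theorem sum_le_sum_of_average {E X : Type*} [Fintype E] [Nonempty E] [Fintype X] (Φ : E → X → X)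
    (hΦ : ∀ ε, (Φ ε).Bijective) (f g : X → ℝ)
    (h : ∀ x, ∑ ε, f (Φ ε x) ≤ Fintype.card E * g x) : ∑ x, f x ≤ ∑ x, g x := by
  have h1 : (Fintype.card E : ℝ) * ∑ x, f x ≤ Fintype.card E * ∑ x, g x := by
    calc (Fintype.card E : ℝ) * ∑ x, f x = ∑ ε : E, ∑ x, f (Φ ε x) := by
          simp_rw [fun ε => (hΦ ε).sum_comp f]
          simp
      _ = ∑ x, ∑ ε : E, f (Φ ε x) := Finset.sum_comm
      _ ≤ ∑ x, Fintype.card E * g x := Finset.sum_le_sum fun x _ => h x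
      _ = _ := by rw [Finset.mul_sum]
  exact le_of_mul_le_mul_left h1 (by exact_mod_cast Fintype.card_pos)

theorem sum_bool_prod {ι : Type*} [Fintype ι] [DecidableEq ι] (f : ι → Bool → ℝ) :
    ∑ ε : ι → Bool, ∏ i, f i (ε i) = ∏ i, (f i false + f i true) := by
  have := Finset.prod_univ_sum (fun _ : ι => (Finset.univ : Finset Bool)) f
  simp only [Fintype.piFinset_univ, Fintype.sum_bool] at this
  rw [← this]
  exact Finset.prod_congr rfl fun i _ => add_comm _ _

/-! ### The first edge of a star in a random order -/

/-- In the order `π`, the element `e (i, inl k)` comes first among all elements `e (i, ·)`. -/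
def IsFirst {ι K B E : Type*} {N : ℕ} (e : ι × (K ⊕ B) → E) (π : Fin N ≃ E) (i : ι) (k : K) : Prop :=
  ∀ b, π.symm (e (i, Sum.inl k)) ≤ π.symm (e (i, b))

theorem IsFirst.unique {ι K B E : Type*} {N : ℕ} {e : ι × (K ⊕ B) → E} (he : e.Injective)
    {π : Fin N ≃ E} {i : ι} {k l : K} (hk : IsFirst e π i k) (hl : IsFirst e π i l) : k = l := by
  have := he (π.symm.injective (le_antisymm (hk (Sum.inl l)) (hl (Sum.inl k))))
  simpa using this

/-- If in each of the disjoint families `e (i, ·)` at least half of the elements are of the form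
`e (i, inl k)`, then the number of families whose first element in a random order is of this form
stochastically dominates a sum of independent fair bits. This is expressed through the expectation of
`(3 / 4) ^ _`. The bits choose the families in which the other elements exchange their positions with
elements of the form `e (i, inl k)`. -/
theorem sum_isFirst_le {ι K B E : Type*} [Fintype ι] [Fintype K] [Fintype B]
    {N : ℕ} [Fintype (Fin N ≃ E)] (e : ι × (K ⊕ B) → E) (he : e.Injective) [Nonempty K]
    [∀ (π : Fin N ≃ E) i, Decidable (∃ k, IsFirst e π i k)] (hBK : Fintype.card B ≤ Fintype.card K) :
    ∑ π : Fin N ≃ E, ∏ i, (if ∃ k, IsFirst e π i k then (3 / 4 : ℝ) else 1) ≤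
      Fintype.card (Fin N ≃ E) * (7 / 8) ^ Fintype.card ι := by
  classical
  obtain ⟨j⟩ := Function.Embedding.nonempty_of_card_le hBK
  let w : (ε : ι → Bool) → {i // ε i = true} × B → E := fun ε a => e (a.1.1, Sum.inr a.2)
  let g : (ε : ι → Bool) → {i // ε i = true} × B → E := fun ε a => e (a.1.1, Sum.inl (j a.2))
  have hw : ∀ ε, (w ε).Injective := by
    intro ε a b h
    have := he h
    simp only [Prod.mk.injEq, Sum.inr.injEq] at this
    exact Prod.ext (Subtype.ext this.1) this.2
  have hg : ∀ ε, (g ε).Injective := by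
    intro ε a b h
    have := he h
    simp only [Prod.mk.injEq, Sum.inl.injEq] at this
    exact Prod.ext (Subtype.ext this.1) (j.injective this.2)
  have hwg : ∀ ε a b, w ε a ≠ g ε b := by
    intro ε a b h
    have := he h
    simp at this
  let ρ : (ι → Bool) → Equiv.Perm E := fun ε =>
    (swapFun_involutive (hw ε) (hg ε) (hwg ε)).toPerm
  have hρ : ∀ ε x, (ρ ε).symm x = swapFun (w ε) (g ε) x := fun _ _ => rfl
  have hfalse : ∀ ε i, ε i = false → ∀ b, (ρ ε).symm (e (i, b)) = e (i, b) := by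
    intro ε i hi b
    rw [hρ]
    apply swapFun_of_notMem
    · rintro a h
      have h1 : a.1.1 = i := congrArg Prod.fst (he h)
      have h2 := a.1.2
      rw [h1, hi] at h2
      cases h2
    · rintro a h
      have h1 : a.1.1 = i := congrArg Prod.fst (he h)
      have h2 := a.1.2
      rw [h1, hi] at h2
      cases h2
  have htrue : ∀ ε i, ε i = true → ∀ b, (ρ ε).symm (e (i, Sum.inl (j b))) = e (i, Sum.inr b) := by
    intro ε i hi b
    exact swapFun_right (hg ε) (hwg ε) (⟨⟨i, hi⟩, b⟩ : {i // ε i = true} × B)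
  have hmem : ∀ ε i b, ∃ b', (ρ ε).symm (e (i, b)) = e (i, b') := by
    intro ε i b
    rw [hρ]
    by_cases h : ∃ a, w ε a = e (i, b)
    · obtain ⟨a, ha⟩ := h
      have h1 : a.1.1 = i := congrArg Prod.fst (he ha)
      rw [← ha, swapFun_left (hw ε), ← h1]
      exact ⟨_, rfl⟩
    by_cases h' : ∃ a, g ε a = e (i, b)
    · obtain ⟨a, ha⟩ := h'
      have h1 : a.1.1 = i := congrArg Prod.fst (he ha)
      rw [← ha, swapFun_right (hg ε) (hwg ε), ← h1]
      exact ⟨_, rfl⟩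
    · push Not at h h'
      exact ⟨b, swapFun_of_notMem h h'⟩
  have key : ∀ (π : Fin N ≃ E) ε i,
      (if ∃ k, IsFirst e (π.trans (ρ ε)) i k then (3 / 4 : ℝ) else 1) ≤
        if (∃ k, IsFirst e π i k) ↔ ε i = false then 3 / 4 else 1 := by
    intro π ε i
    have : ((∃ k, IsFirst e π i k) ↔ ε i = false) → ∃ k, IsFirst e (π.trans (ρ ε)) i k := by
      intro h
      by_cases hk : ∃ k, IsFirst e π i k
      · have hi := h.1 hk
        obtain ⟨k, hk⟩ := hk
        refine ⟨k, fun b => ?_⟩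
        rw [Equiv.symm_trans_apply, Equiv.symm_trans_apply, hfalse ε i hi, hfalse ε i hi]
        exact hk b
      · have hi : ε i = true := by
          cases hε : ε i
          · exact absurd (h.2 hε) hk
          · rfl
        obtain ⟨b₀, hb₀⟩ := Finite.exists_min fun b => π.symm (e (i, b))
        rcases b₀ with k | b₀
        · exact absurd ⟨k, hb₀⟩ hk
        · refine ⟨j b₀, fun b => ?_⟩
          obtain ⟨b', hb'⟩ := hmem ε i b
          rw [Equiv.symm_trans_apply, Equiv.symm_trans_apply, htrue ε i hi, hb']
          exact hb₀ b'
    by_cases h : (∃ k, IsFirst e π i k) ↔ ε i = false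
    · rw [if_pos h, if_pos (this h)]
    · rw [if_neg h]
      split_ifs <;> norm_num
  calc ∑ π : Fin N ≃ E, ∏ i, (if ∃ k, IsFirst e π i k then (3 / 4 : ℝ) else 1)
      ≤ ∑ _π : Fin N ≃ E, (7 / 8 : ℝ) ^ Fintype.card ι := by
        refine sum_le_sum_of_average (E := ι → Bool) (fun ε π => π.trans (ρ ε))
          (fun ε => ?_) _ _ (fun π => ?_)
        · refine ⟨fun a b h => ?_, fun a => ⟨a.trans (ρ ε).symm, ?_⟩⟩
          · ext x
            exact (ρ ε).injective (congrArg (fun q : Fin N ≃ E => q x) h)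
          · ext x
            simp
        · calc _ ≤ ∑ ε : ι → Bool, ∏ i,
                (if (∃ k, IsFirst e π i k) ↔ ε i = false then (3 / 4 : ℝ) else 1) := by
                refine Finset.sum_le_sum fun ε _ => Finset.prod_le_prod (fun i _ => ?_)
                  fun i _ => key π ε i
                split_ifs <;> norm_num
            _ = ∏ i : ι, (7 / 4 : ℝ) := by
                rw [sum_bool_prod
                  (fun i b => if (∃ k, IsFirst e π i k) ↔ b = false then (3 / 4 : ℝ) else 1)]
                refine Finset.prod_congr rfl fun i _ => ?_
                by_cases h : ∃ k, IsFirst e π i k <;> simp [h] <;> norm_num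
            _ = _ := by
                simp only [Finset.prod_const, Finset.card_univ, Fintype.card_fun, Fintype.card_bool]
                push_cast
                rw [← mul_pow]
                norm_num
    _ = _ := by simp

/-- A map on bit vectors whose `i`-th output, for `i` in `G`, flips with the `i`-th input once the
inputs with an earlier time stamp in `G` are fixed, and which copies the bits outside `G`, is
bijective. -/
theorem bijective_of_triangular {ι : Type*} [Finite ι] {G : ι → Prop} {τ : ι → ℕ}
    (H : (ι → Bool) → ι → Bool) (hG : ∀ ε i, ¬ G i → H ε i = ε i)
    (hH : ∀ ε ε' i, G i → ε i ≠ ε' i → (∀ j, G j → τ j < τ i → ε j = ε' j) → H ε i ≠ H ε' i) :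
    H.Bijective := by
  refine Finite.injective_iff_bijective.1 fun ε ε' h => ?_
  by_contra hne
  obtain ⟨i₀, hi₀⟩ := Function.ne_iff.1 hne
  have key : ∀ n i, τ i = n → ε i = ε' i := by
    intro n
    induction n using Nat.strong_induction_on with
    | _ n ih =>
      intro i hi
      by_contra hi'
      by_cases hg : G i
      · exact hH ε ε' i hg hi' (fun j _ hj => ih _ (hi ▸ hj) j rfl) (congrFun h i)
      · exact hi' (by rw [← hG ε i hg, ← hG ε' i hg, h])
  exact hi₀ (key _ i₀ rfl)

/-! ### Uniform averages -/

theorem unifExp_eq_sum {α : Type*} [Fintype α] (f : α → ℝ≥0∞) :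
    unifExp f = (∑ a, f a) / (Fintype.card α : ℝ≥0∞) := by
  rw [unifExp, tsum_fintype, Nat.card_eq_fintype_card]

theorem unifExp_mono {α : Type*} [Finite α] {f g : α → ℝ≥0∞} (h : ∀ a, f a ≤ g a) :
    unifExp f ≤ unifExp g :=
  ENNReal.div_le_div_right (ENNReal.tsum_le_tsum h) _

theorem unifExp_const {α : Type*} [Finite α] [Nonempty α] (c : ℝ≥0∞) :
    unifExp (fun _ : α => c) = c := by
  have := Fintype.ofFinite α
  rw [unifExp_eq_sum, Finset.sum_const, Finset.card_univ, nsmul_eq_mul, mul_comm]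
  exact ENNReal.mul_div_cancel_right (by simp) (by simp)

theorem unifExp_comp_equiv {α β : Type*} [Finite α] [Finite β] (φ : α ≃ β) (f : β → ℝ≥0∞) :
    unifExp (fun a => f (φ a)) = unifExp f := by
  rw [unifExp, unifExp, φ.tsum_eq, Nat.card_congr φ]

theorem unifExp_const_mul {α : Type*} [Finite α] (c : ℝ≥0∞) (f : α → ℝ≥0∞) :
    unifExp (fun a => c * f a) = c * unifExp f := by
  rw [unifExp, unifExp, ENNReal.tsum_mul_left, mul_div_assoc]

theorem unifExp_prod {α β : Type*} [Finite α] [Finite β] (f : α × β → ℝ≥0∞) :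
    unifExp f = unifExp fun a => unifExp fun b => f (a, b) := by
  simp only [unifExp]
  simp_rw [div_eq_mul_inv, ENNReal.tsum_mul_right]
  rw [ENNReal.tsum_prod', Nat.card_prod, Nat.cast_mul, mul_assoc,
    ENNReal.mul_inv (by simp) (by simp), mul_comm (_⁻¹ : ℝ≥0∞)]

theorem lintegral_unifExp {α Ω : Type*} [Finite α] [MeasurableSpace Ω] (P : Measure Ω)
    {f : Ω → α → ℝ≥0∞} (hf : ∀ a, Measurable fun ω => f ω a) :
    ∫⁻ ω, unifExp (f ω) ∂P = unifExp fun a => ∫⁻ ω, f ω a ∂P := by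
  have := Fintype.ofFinite α
  simp only [unifExp_eq_sum, div_eq_mul_inv]
  rw [lintegral_mul_const _ (Finset.measurable_sum _ fun a _ => hf a),
    lintegral_finsetSum _ fun a _ => hf a]

theorem exists_unifExp_le {α : Type*} [Finite α] [Nonempty α] (f : α → ℝ≥0∞) :
    ∃ a, unifExp f ≤ f a := by
  obtain ⟨a, ha⟩ := Finite.exists_max f
  exact ⟨a, (unifExp_mono ha).trans (unifExp_const _).le⟩

/-- If at most a fraction `1 / n` of the points lies outside `s`, then a uniform point lies in `s` with
probability at least `1 - 1 / n`. -/
theorem one_sub_inv_le_unifExp_indicator {α : Type*} [Finite α] [Nonempty α] (s : Set α) (n : ℕ)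
    (h : (sᶜ.ncard : ℝ) * n ≤ Nat.card α) :
    1 - (n : ℝ≥0∞)⁻¹ ≤ unifExp (s.indicator 1) := by
  classical
  rcases Nat.eq_zero_or_pos n with rfl | hn
  · simp
  have := Fintype.ofFinite α
  have h1 : (1 : ℝ≥0∞) = unifExp (s.indicator 1) + unifExp (sᶜ.indicator 1) := by
    rw [unifExp, unifExp, ← ENNReal.add_div, ← ENNReal.tsum_add]
    rw [← unifExp_const (α := α) 1, unifExp]
    congr 1
    refine tsum_congr fun a => ?_
    by_cases ha : a ∈ s <;> simp [ha]
  have h2 : unifExp (sᶜ.indicator (1 : α → ℝ≥0∞)) ≤ (n : ℝ≥0∞)⁻¹ := by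
    have h3 : ∑ a, sᶜ.indicator (1 : α → ℝ≥0∞) a = (sᶜ.ncard : ℝ≥0∞) := by
      rw [Set.ncard_eq_toFinset_card', Finset.sum_indicator_eq_sum_filter]
      simp [Set.toFinset_compl]
      congr 1
      ext
      simp
    rw [unifExp_eq_sum, h3, ENNReal.div_le_iff (by simp) (by simp), mul_comm,
      ← div_eq_mul_inv, ENNReal.le_div_iff_mul_le (by simp [hn.ne']) (by simp),
      ← Nat.card_eq_fintype_card]
    exact_mod_cast h
  rw [tsub_le_iff_right]
  calc (1 : ℝ≥0∞) = _ := h1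
    _ ≤ _ := by gcongr

/-! ### Structure of the recursive tree -/

namespace HardNode

variable {D : ℕ}

/-- The distance of a node from the root. -/
def depth : {d : ℕ} → HardNode D d → ℕ
  | _, root _ => 0
  | _, sub _ _ x => depth x + 1

theorem depth_le {d : ℕ} (x : HardNode D d) : x.depth ≤ d := by
  induction x with
  | root d => simp [depth]
  | sub d' i x ih => have := d'.2; simp only [depth]; omega

theorem exists_depth_eq (D d : ℕ) : ∃ x : HardNode D d, x.depth = d := by
  induction d with
  | zero => exact ⟨root 0, rfl⟩
  | succ d ih =>
    obtain ⟨x, hx⟩ := ih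
    exact ⟨sub (Fin.last d) ⟨0, by positivity⟩ x, by simp only [depth]; exact congrArg (· + 1) hx⟩

theorem IsChild.depth_eq {d : ℕ} {x y : HardNode D d} (h : IsChild x y) :
    y.depth = x.depth + 1 := by
  induction h with
  | root d' i => rfl
  | sub d' i h ih => simp only [depth, ih]

theorem IsChild.ne {d : ℕ} {x y : HardNode D d} (h : IsChild x y) : x ≠ y := by
  rintro rfl
  have := h.depth_eq
  omega

theorem IsChild.parent_unique {d : ℕ} {x x' y : HardNode D d} (h : IsChild x y)
    (h' : IsChild x' y) : x = x' := by
  induction h with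
  | root d' i =>
    cases h' with
    | root => rfl
    | sub _ _ h' => nomatch h'
  | sub d' i h ih =>
    cases h' with
    | root => nomatch h
    | sub _ _ h' => rw [ih h']

theorem exists_isChild {d : ℕ} (y : HardNode D d) (hy : y ≠ root d) : ∃ x, IsChild x y := by
  induction y with
  | root => exact absurd rfl hy
  | sub d' i y ih =>
    by_cases h : y = root d'
    · subst h
      exact ⟨_, .root d' i⟩
    · obtain ⟨x, hx⟩ := ih h
      exact ⟨_, .sub d' i hx⟩

theorem IsChild.ne_root {d : ℕ} {x y : HardNode D d} (h : IsChild x y) : y ≠ .root d := by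
  rintro rfl
  have := h.depth_eq
  simp [depth] at this

/-- An edge determines which of its endpoints is the parent. -/
theorem IsChild.eq_of_sym2_eq {d : ℕ} {x y x' y' : HardNode D d} (h : IsChild x y)
    (h' : IsChild x' y') (he : s(x, y) = s(x', y')) : x = x' ∧ y = y' := by
  rcases Sym2.eq_iff.1 he with he | ⟨rfl, rfl⟩
  · exact he
  · have h1 := h.depth_eq
    have h2 := h'.depth_eq
    omega

theorem card_succ (D d : ℕ) : Nat.card (HardNode D (d + 1)) =
    (1 + 2 ^ (D - d)) * Nat.card (HardNode D d) := by
  have key : ∀ d, Nat.card (HardNode D d) =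
      1 + ∑ d' : Fin d, 2 ^ (D - (d' : ℕ)) * Nat.card (HardNode D d') := by
    intro d
    let φ : Option (Σ d' : Fin d, Fin (2 ^ (D - (d' : ℕ))) × HardNode D d') ≃ HardNode D d :=
      { toFun := fun o => match o with
          | none => root d
          | some ⟨d', i, x⟩ => sub d' i x
        invFun := fun y => match y with
          | root _ => none
          | sub d' i x => some ⟨d', i, x⟩
        left_inv := fun o => by rcases o with _ | ⟨d', i, x⟩ <;> rfl
        right_inv := fun y => by cases y <;> rfl }
    rw [← Nat.card_congr φ, Finite.card_option, Nat.card_sigma, add_comm]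
    simp
  rw [key (d + 1), Fin.sum_univ_castSucc, ← add_assoc]
  simp only [Fin.val_castSucc, Fin.val_last]
  rw [← key d]
  ring

theorem card_zero (D : ℕ) : Nat.card (HardNode D 0) = 1 := by
  have : Subsingleton (HardNode D 0) := ⟨fun x y => by
    cases x with
    | root => cases y with
      | root => rfl
      | sub d' => exact d'.elim0
    | sub d' => exact d'.elim0⟩
  have : Nonempty (HardNode D 0) := ⟨root 0⟩
  exact Nat.card_unique

end HardNode

open HardNode

theorem hardSize_le (D : ℕ) : hardSize D ≤ 4 ^ (D ^ 2) := by
  have key : ∀ d, Nat.card (HardNode D d) ≤ 2 ^ ((D + 1) * d) := by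
    intro d
    induction d with
    | zero => simp [HardNode.card_zero]
    | succ d ih =>
      rw [HardNode.card_succ, mul_add, pow_add, mul_comm]
      refine Nat.mul_le_mul ih ?_
      have h1 : 2 ^ (D - d) ≤ 2 ^ D := Nat.pow_le_pow_right two_pos (Nat.sub_le _ _)
      have h2 : 1 ≤ 2 ^ D := Nat.one_le_two_pow
      rw [mul_one, pow_succ]
      omega
  refine (key D).trans ?_
  rw [show 4 = 2 ^ 2 by rfl, ← pow_mul]
  refine Nat.pow_le_pow_right two_pos ?_
  rcases Nat.eq_zero_or_pos D with rfl | h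
  · simp
  · nlinarith

theorem lt_hardSize (D : ℕ) : D < hardSize D := by
  have key : ∀ d, d < Nat.card (HardNode D d) := by
    intro d
    induction d with
    | zero => simp [HardNode.card_zero]
    | succ d ih =>
      rw [HardNode.card_succ]
      have : 1 ≤ 2 ^ (D - d) := Nat.one_le_two_pow
      nlinarith
  exact key D

theorem hardSize_one : hardSize 1 = 3 := by
  rw [hardSize, HardNode.card_succ, HardNode.card_zero]
  norm_num

section Tree

variable {D : ℕ}

theorem hardTree_adj {x y : HardNode D D} :
    (hardTree D).Adj x y ↔ IsChild x y ∨ IsChild y x := by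
  rw [hardTree, SimpleGraph.fromRel_adj]
  exact ⟨fun h => h.2, fun h => ⟨h.elim IsChild.ne fun h => h.ne.symm, h⟩⟩

/-- The edge from a parent to its child. -/
def HardNode.IsChild.edge {x y : HardNode D D} (h : IsChild x y) : (hardTree D).edgeSet :=
  ⟨s(x, y), hardTree_adj.2 (Or.inl h)⟩

theorem exists_eq_edge (f : (hardTree D).edgeSet) :
    ∃ (x y : HardNode D D) (h : IsChild x y), f = h.edge := by
  obtain ⟨f, hf⟩ := f
  induction f with
  | _ x y =>
    rcases hardTree_adj.1 hf with h | h
    · exact ⟨x, y, h, rfl⟩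
    · exact ⟨y, x, h, Subtype.ext Sym2.eq_swap⟩

theorem HardNode.IsChild.edge_inj {x y x' y' : HardNode D D} {h : IsChild x y} {h' : IsChild x' y'}
    (he : h.edge = h'.edge) : y = y' :=
  (h.eq_of_sym2_eq h' (congrArg Subtype.val he)).2

/-- Edges correspond to nodes other than the root: an edge corresponds to its lower endpoint. -/
theorem exists_childEquiv (D : ℕ) :
    ∃ φ : (hardTree D).edgeSet ≃ {y : HardNode D D // y ≠ root D},
      ∀ f : (hardTree D).edgeSet, ((φ f : HardNode D D)) ∈ f.1 := by
  choose p c hpc hf using exists_eq_edge (D := D)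
  refine ⟨Equiv.ofBijective (fun f => ⟨c f, (hpc f).ne_root⟩) ⟨fun f f' h => ?_, fun y => ?_⟩,
    fun f => ?_⟩
  · have hc : c f = c f' := congrArg Subtype.val h
    have hp : p f = p f' := (hc ▸ hpc f).parent_unique (hpc f')
    have h1 := hf f
    have h2 := hf f'
    rw [h1, h2]
    simp only [IsChild.edge, hc, hp]
  · obtain ⟨x, hx⟩ := exists_isChild y.1 y.2
    exact ⟨hx.edge, Subtype.ext ((IsChild.edge_inj (hf hx.edge)).symm)⟩
  · have := congrArg Subtype.val (hf f)
    simp only [this, IsChild.edge]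
    exact Sym2.mem_mk_right _ _

theorem exists_walk (x : HardNode D D) :
    ∃ p : (hardTree D).Walk (root D) x, p.length = x.depth := by
  obtain ⟨n, hn⟩ : ∃ n, x.depth = n := ⟨_, rfl⟩
  induction n generalizing x with
  | zero =>
    cases x with
    | root => exact ⟨.nil, rfl⟩
    | sub => simp [depth] at hn
  | succ n ih =>
    obtain ⟨y, hy⟩ := exists_isChild x (by rintro rfl; simp [depth] at hn)
    have hd := hy.depth_eq
    obtain ⟨p, hp⟩ := ih y (by omega)
    refine ⟨p.concat (hardTree_adj.2 (Or.inl hy)), ?_⟩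
    rw [SimpleGraph.Walk.length_concat]
    omega

theorem dist_root (x : HardNode D D) : (hardTree D).dist (root D) x = x.depth := by
  obtain ⟨p, hp⟩ := exists_walk x
  refine le_antisymm (hp ▸ SimpleGraph.dist_le p) ?_
  obtain ⟨q, hq⟩ := p.reachable.exists_walk_length_eq_dist
  rw [← hq]
  have key : ∀ {a b : HardNode D D} (q : (hardTree D).Walk a b), b.depth ≤ a.depth + q.length := by
    intro a b q
    induction q with
    | nil => simp
    | cons h q ih =>
      rw [SimpleGraph.Walk.length_cons]
      rcases hardTree_adj.1 h with h | h <;> have := h.depth_eq <;> omega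
  simpa [depth] using key q

theorem isGreatest_dist (D : ℕ) : IsGreatest (Set.range ((hardTree D).dist (root D))) D := by
  constructor
  · obtain ⟨x, hx⟩ := exists_depth_eq D D
    exact ⟨x, by rw [dist_root, hx]⟩
  · rintro _ ⟨x, rfl⟩
    rw [dist_root]
    exact x.depth_le

theorem hardTree_isTree (D : ℕ) : (hardTree D).IsTree := by
  rw [SimpleGraph.isTree_iff_connected_and_card]
  constructor
  · have hroot : ∀ x, (hardTree D).Reachable (root D) x := fun x => (exists_walk x).choose.reachable
    have : Nonempty (HardNode D D) := ⟨root D⟩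
    exact ⟨fun x y => (hroot x).symm.trans (hroot y)⟩
  · classical
    obtain ⟨φ, -⟩ := exists_childEquiv D
    rw [Nat.card_congr φ, ← Finite.card_option]
    exact Nat.card_congr (Equiv.optionSubtypeNe (root D))

theorem le_maxInDegree {ι V : Type*} [Finite ι] [Finite V] (head : ι → V) (v : V) :
    {t : ι | head t = v}.ncard ≤ maxInDegree head :=
  le_ciSup (f := fun v => {t : ι | head t = v}.ncard) (Set.finite_range _).bddAbove v

theorem one_le_maxInDegree {ι V : Type*} [Finite ι] [Nonempty ι] [Finite V] (head : ι → V) :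
    1 ≤ maxInDegree head := by
  obtain ⟨t⟩ := ‹Nonempty ι›
  refine le_trans ?_ (le_maxInDegree head (head t))
  exact (Set.ncard_pos).2 ⟨t, rfl⟩

theorem nonempty_edgeSet (hD : 1 ≤ D) : Nonempty (hardTree D).edgeSet :=
  ⟨(IsChild.root (⟨0, hD⟩ : Fin D) ⟨0, by positivity⟩).edge⟩

/-- Orienting every edge towards its lower endpoint is optimal. -/
theorem exists_orientation (D : ℕ) : ∃ head : (hardTree D).edgeSet → HardNode D D,
    head.Injective ∧ ∀ e : (hardTree D).edgeSet, head e ∈ e.1 := by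
  obtain ⟨φ, hφ⟩ := exists_childEquiv D
  exact ⟨fun f => φ f, Subtype.val_injective.comp φ.injective, hφ⟩

theorem isLeast_orientationLoads (hD : 1 ≤ D) : IsLeast (orientationLoads (hardTree D)) 1 := by
  have := nonempty_edgeSet hD
  constructor
  · obtain ⟨head, hinj, hmem⟩ := exists_orientation D
    refine ⟨head, hmem, le_antisymm ?_ (one_le_maxInDegree head)⟩
    have : Nonempty (HardNode D D) := ⟨root D⟩
    refine ciSup_le fun v => (Set.ncard_le_one_iff).2 fun ha hb => hinj ?_
    exact Eq.trans ha (Eq.symm hb)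
  · rintro _ ⟨head, -, rfl⟩
    exact one_le_maxInDegree head

end Tree

/-! ### Exchanging a child with the matching part of its parent -/

/-- The inclusion of `T_{d'}` in `T_d` for `d' < d` that identifies the two roots. -/
def HardNode.widen {D d : ℕ} (d' : Fin d) : HardNode D d' → HardNode D d
  | root _ => root d
  | sub j i x => sub ⟨j, j.2.trans d'.2⟩ i x

section Star

variable {D : ℕ} (d : Fin D) (d' : Fin (d : ℕ))

/-- Indices for the edges, other than those to children of level `d'`, that join the root of a copy
of `T_d` to its parent (`none`) or to its children of level greater than `d'`. -/
abbrev StarOther : Type :=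
  Option (Σ j : {j : Fin (d : ℕ) // d' < j}, Fin (2 ^ (D - (j : ℕ))))

/-- Indices for all the edges that join the root of the `i`-th copy of `T_d` below the root of `T_D`
to its parent or to its children of level at least `d'`. -/
abbrev StarIndex : Type :=
  Fin (2 ^ (D - (d : ℕ))) × (Fin (2 ^ (D - (d' : ℕ))) ⊕ StarOther d d')

/-- The root of the `i`-th copy of `T_d` below the root of `T_D`. -/
def hub (i : Fin (2 ^ (D - (d : ℕ)))) : HardNode D D := sub d i (root _)

/-- The lower endpoint of an edge of the star. -/
def starChild : StarIndex d d' → HardNode D D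
  | (i, .inl k) => sub d i (sub d' k (root _))
  | (i, .inr none) => hub d i
  | (i, .inr (some ⟨j, l⟩)) => sub d i (sub j.1 l (root _))

/-- The upper endpoint of an edge of the star. -/
def starParent : StarIndex d d' → HardNode D D
  | (i, .inl _) => hub d i
  | (_, .inr none) => root D
  | (i, .inr (some _)) => hub d i

theorem isChild_star (p : StarIndex d d') : IsChild (starParent d d' p) (starChild d d' p) := by
  rcases p with ⟨i, k | _ | ⟨j, l⟩⟩
  · exact .sub d i (.root d' k)
  · exact .root d i
  · exact .sub d i (.root j.1 l)

/-- The edges at the roots of the copies of `T_d`. -/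
def starEdge (p : StarIndex d d') : (hardTree D).edgeSet := (isChild_star d d' p).edge

theorem starChild_injective : (starChild d d').Injective := by
  rintro ⟨i, k | _ | ⟨⟨j, hj⟩, l⟩⟩ ⟨i', k' | _ | ⟨⟨j', hj'⟩, l'⟩⟩ h <;>
    simp only [starChild, hub] at h <;> cases h <;> first | rfl | exact absurd hj (lt_irrefl _) |
      exact absurd hj' (lt_irrefl _)

theorem starEdge_injective : (starEdge d d').Injective := fun _ _ h =>
  starChild_injective d d' (IsChild.edge_inj h)

theorem card_starOther_le :
    Fintype.card (StarOther d d') ≤ Fintype.card (Fin (2 ^ (D - (d' : ℕ)))) := by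
  have hd := d.2
  -- The blocks of sizes `2 ^ (D - j)` fit into the disjoint dyadic intervals `[2 ^ a, 2 ^ (a + 1))`.
  have hlt : ∀ (j : {j : Fin (d : ℕ) // d' < j}) (l : Fin (2 ^ (D - (j.1 : ℕ)))),
      2 ^ (D - (j.1 : ℕ)) + (l : ℕ) < 2 ^ (D - (d' : ℕ)) := by
    intro j l
    have h1 := l.2
    have h2 : (d' : ℕ) < (j.1 : ℕ) := j.2
    have h3 := j.1.2
    have h4 : 2 ^ (D - (j.1 : ℕ) + 1) ≤ 2 ^ (D - (d' : ℕ)) :=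
      Nat.pow_le_pow_right two_pos (by omega)
    rw [pow_succ] at h4
    omega
  let f : StarOther d d' → Fin (2 ^ (D - (d' : ℕ))) := fun o => match o with
    | none => ⟨0, by positivity⟩
    | some ⟨j, l⟩ => ⟨2 ^ (D - (j.1 : ℕ)) + (l : ℕ), hlt j l⟩
  refine Fintype.card_le_of_injective f ?_
  have hpos : ∀ a : ℕ, 0 < 2 ^ a := fun a => by positivity
  have hlog : ∀ a l : ℕ, l < 2 ^ a → Nat.log 2 (2 ^ a + l) = a := fun a l hl =>
    Nat.log_eq_of_pow_le_of_lt_pow (by omega) (by rw [pow_succ]; omega)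
  rintro (_ | ⟨⟨j, hj⟩, l⟩) (_ | ⟨⟨j', hj'⟩, l'⟩) h
  · rfl
  · have := congrArg Fin.val h
    have := hpos (D - j')
    simp only [f] at *
    omega
  · have := congrArg Fin.val h
    have := hpos (D - j)
    simp only [f] at *
    omega
  · have h1 : 2 ^ (D - (j : ℕ)) + (l : ℕ) = 2 ^ (D - (j' : ℕ)) + (l' : ℕ) := congrArg Fin.val h
    have h2 := congrArg (Nat.log 2) h1
    rw [hlog _ _ l.2, hlog _ _ l'.2] at h2
    change D - (j : ℕ) = D - (j' : ℕ) at h2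
    have h3 : j = j' := Fin.ext (by have := j.2; have := j'.2; omega)
    subst h3
    have h4 : l = l' := Fin.ext (by omega)
    rw [h4]

variable (v : Fin (2 ^ (D - (d : ℕ))) → Option (Fin (2 ^ (D - (d' : ℕ)))))

/-- The nodes of one copy of `T_{d'}` for each index `i` at which `v i` selects a child. -/
abbrev Selected : Type :=
  {p : Fin (2 ^ (D - (d : ℕ))) × Fin (2 ^ (D - (d' : ℕ))) // v p.1 = some p.2} × HardNode D d'

/-- The copy of `T_{d'}` that consists of a hub and its child subtrees of level less than `d'`. -/
def upperCopy (a : Selected d d' v) : HardNode D D := sub d a.1.1.1 (widen d' a.2)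

/-- The copy of `T_{d'}` that hangs below the selected child of a hub. -/
def lowerCopy (a : Selected d d' v) : HardNode D D := sub d a.1.1.1 (sub d' a.1.1.2 a.2)

theorem widen_injective {d : ℕ} (d' : Fin d) : (widen (D := D) d').Injective := by
  intro x y h
  cases x with
  | root =>
    cases y with
    | root => rfl
    | sub => nomatch h
  | sub j i x =>
    cases y with
    | root => nomatch h
    | sub j' i' y =>
      simp only [widen, HardNode.sub.injEq, Fin.mk.injEq] at h
      obtain ⟨h1, h2, h3⟩ := h
      obtain rfl := Fin.ext h1
      rw [eq_of_heq h2, eq_of_heq h3]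

theorem widen_ne_sub {d : ℕ} (d' : Fin d) (x : HardNode D d') {j : Fin d} (hj : d' ≤ j)
    (l : Fin (2 ^ (D - (j : ℕ)))) (y : HardNode D j) : widen d' x ≠ sub j l y := by
  intro h
  cases x with
  | root => nomatch h
  | sub j' i' x =>
    simp only [widen, HardNode.sub.injEq] at h
    have h1 : (j' : ℕ) = j := congrArg Fin.val h.1
    have h2 := j'.2
    have h3 : (d' : ℕ) ≤ j := hj
    omega

theorem upperCopy_injective : (upperCopy d d' v).Injective := by
  rintro ⟨⟨⟨i, k⟩, h⟩, x⟩ ⟨⟨⟨i', k'⟩, h'⟩, x'⟩ he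
  simp only [upperCopy, HardNode.sub.injEq, heq_eq_eq, true_and] at he
  obtain ⟨rfl, hx⟩ := he
  obtain rfl := widen_injective d' hx
  simp only at h h'
  obtain rfl := Option.some.inj (h.symm.trans h')
  rfl

theorem lowerCopy_injective : (lowerCopy d d' v).Injective := by
  rintro ⟨⟨⟨i, k⟩, h⟩, x⟩ ⟨⟨⟨i', k'⟩, h'⟩, x'⟩ he
  simp only [lowerCopy, HardNode.sub.injEq, heq_eq_eq, true_and] at he
  obtain ⟨rfl, rfl, rfl⟩ := he
  rfl

theorem upperCopy_ne_lowerCopy (a b : Selected d d' v) :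
    upperCopy d d' v a ≠ lowerCopy d d' v b := by
  intro h
  simp only [upperCopy, lowerCopy, HardNode.sub.injEq, heq_eq_eq, true_and] at h
  exact widen_ne_sub d' a.2 le_rfl _ _ h.2

theorem nodeSwap_involutive :
    Function.Involutive (swapFun (upperCopy d d' v) (lowerCopy d d' v)) :=
  swapFun_involutive (upperCopy_injective d d' v) (lowerCopy_injective d d' v)
    (upperCopy_ne_lowerCopy d d' v)

/-- The permutation of the nodes of `T_D` that, for each `i` at which `v i` selects a child of the
`i`-th hub, exchanges the two copies of `T_{d'}` rooted at the hub and at the child. -/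
noncomputable def nodeSwap : Equiv.Perm (HardNode D D) := (nodeSwap_involutive d d' v).toPerm

theorem nodeSwap_nodeSwap (x : HardNode D D) : nodeSwap d d' v (nodeSwap d d' v x) = x :=
  nodeSwap_involutive d d' v x

variable {d d' v}

theorem nodeSwap_upper {i : Fin (2 ^ (D - (d : ℕ)))} {k : Fin (2 ^ (D - (d' : ℕ)))}
    (h : v i = some k) (x : HardNode D d') :
    nodeSwap d d' v (sub d i (widen d' x)) = sub d i (sub d' k x) :=
  swapFun_left (upperCopy_injective d d' v) (⟨⟨(i, k), h⟩, x⟩ : Selected d d' v)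

theorem nodeSwap_lower {i : Fin (2 ^ (D - (d : ℕ)))} {k : Fin (2 ^ (D - (d' : ℕ)))}
    (h : v i = some k) (x : HardNode D d') :
    nodeSwap d d' v (sub d i (sub d' k x)) = sub d i (widen d' x) :=
  swapFun_right (lowerCopy_injective d d' v) (upperCopy_ne_lowerCopy d d' v)
    (⟨⟨(i, k), h⟩, x⟩ : Selected d d' v)

theorem nodeSwap_root : nodeSwap d d' v (root D) = root D :=
  swapFun_of_notMem (fun _ h => nomatch h) (fun _ h => nomatch h)

theorem nodeSwap_of_ne {d₁ : Fin D} (hd : d₁ ≠ d) (i : Fin (2 ^ (D - (d₁ : ℕ))))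
    (x : HardNode D d₁) : nodeSwap d d' v (sub d₁ i x) = sub d₁ i x := by
  refine swapFun_of_notMem (fun a h => ?_) (fun a h => ?_)
  · rw [upperCopy, HardNode.sub.injEq] at h
    exact hd h.1.symm
  · rw [lowerCopy, HardNode.sub.injEq] at h
    exact hd h.1.symm

theorem nodeSwap_of_none {i : Fin (2 ^ (D - (d : ℕ)))} (hi : v i = none) (x : HardNode D d) :
    nodeSwap d d' v (sub d i x) = sub d i x := by
  refine swapFun_of_notMem (fun a h => ?_) (fun a h => ?_)
  · simp only [upperCopy, HardNode.sub.injEq, heq_eq_eq, true_and] at h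
    have := a.1.2
    rw [h.1, hi] at this
    cases this
  · simp only [lowerCopy, HardNode.sub.injEq, heq_eq_eq, true_and] at h
    have := a.1.2
    rw [h.1, hi] at this
    cases this

theorem nodeSwap_of_lt (i : Fin (2 ^ (D - (d : ℕ)))) {j : Fin (d : ℕ)} (hj : d' < j)
    (l : Fin (2 ^ (D - (j : ℕ)))) (x : HardNode D j) :
    nodeSwap d d' v (sub d i (sub j l x)) = sub d i (sub j l x) := by
  refine swapFun_of_notMem (fun a h => ?_) (fun a h => ?_)
  · simp only [upperCopy, HardNode.sub.injEq, heq_eq_eq, true_and] at h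
    exact widen_ne_sub d' _ hj.le _ _ h.2
  · simp only [lowerCopy, HardNode.sub.injEq, heq_eq_eq, true_and] at h
    exact hj.ne h.2.1

theorem nodeSwap_of_unselected {i : Fin (2 ^ (D - (d : ℕ)))} {l : Fin (2 ^ (D - (d' : ℕ)))}
    (hl : v i ≠ some l) (x : HardNode D d') :
    nodeSwap d d' v (sub d i (sub d' l x)) = sub d i (sub d' l x) := by
  refine swapFun_of_notMem (fun a h => ?_) (fun a h => ?_)
  · simp only [upperCopy, HardNode.sub.injEq, heq_eq_eq, true_and] at h
    exact widen_ne_sub d' _ le_rfl _ _ h.2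
  · simp only [lowerCopy, HardNode.sub.injEq, heq_eq_eq, true_and] at h
    have := a.1.2
    rw [h.1, h.2.1] at this
    exact hl this

theorem nodeSwap_hub {i : Fin (2 ^ (D - (d : ℕ)))} {k : Fin (2 ^ (D - (d' : ℕ)))}
    (h : v i = some k) : nodeSwap d d' v (hub d i) = starChild d d' (i, .inl k) :=
  nodeSwap_upper h (root _)

theorem nodeSwap_starChild {i : Fin (2 ^ (D - (d : ℕ)))} {k : Fin (2 ^ (D - (d' : ℕ)))}
    (h : v i = some k) : nodeSwap d d' v (starChild d d' (i, .inl k)) = hub d i :=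
  nodeSwap_lower h (root _)

/-- Outside the stars the exchange is an automorphism, since both exchanged parts are copies of
`T_{d'}`. -/
theorem isChild_nodeSwap {x y : HardNode D D} (h : IsChild x y)
    (hs : ∀ p, starEdge d d' p ≠ h.edge) :
    IsChild (nodeSwap d d' v x) (nodeSwap d d' v y) := by
  cases h with
  | root d₁ i =>
    by_cases hd : d₁ = d
    · subst hd
      exact absurd rfl (hs (i, .inr none))
    · rw [nodeSwap_root, nodeSwap_of_ne hd]
      exact .root d₁ i
  | sub d₁ i h =>
    by_cases hd : d₁ = d
    swap
    · rw [nodeSwap_of_ne hd, nodeSwap_of_ne hd]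
      exact .sub d₁ i h
    subst hd
    rcases hv : v i with _ | k
    · rw [nodeSwap_of_none hv, nodeSwap_of_none hv]
      exact .sub d₁ i h
    cases h with
    | root j l =>
      rcases lt_trichotomy j d' with hj | rfl | hj
      · have hj' : (j : ℕ) < d' := hj
        have h1 := nodeSwap_upper hv (root _)
        have h2 := nodeSwap_upper hv (sub (⟨j, hj'⟩ : Fin (d' : ℕ)) l (root _))
        simp only [widen] at h1 h2
        rw [h1, h2]
        exact .sub d₁ i (.sub d' k (.root (⟨j, hj'⟩ : Fin (d' : ℕ)) l))
      · exact absurd rfl (hs (i, .inl l))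
      · exact absurd rfl (hs (i, .inr (some ⟨⟨j, hj⟩, l⟩)))
    | sub j l h =>
      rename_i x y
      rcases lt_trichotomy j d' with hj | rfl | hj
      · have hj' : (j : ℕ) < d' := hj
        have h1 := nodeSwap_upper hv (sub (⟨j, hj'⟩ : Fin (d' : ℕ)) l x)
        have h2 := nodeSwap_upper hv (sub (⟨j, hj'⟩ : Fin (d' : ℕ)) l y)
        simp only [widen] at h1 h2
        rw [h1, h2]
        exact .sub d₁ i (.sub d' k (.sub (⟨j, hj'⟩ : Fin (d' : ℕ)) l h))
      · by_cases hl : v i = some l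
        · rw [nodeSwap_lower hl, nodeSwap_lower hl]
          refine .sub d₁ i ?_
          cases h with
          | root a b => exact .root (⟨a, a.2.trans j.2⟩ : Fin (d₁ : ℕ)) b
          | sub a b h => exact .sub (⟨a, a.2.trans j.2⟩ : Fin (d₁ : ℕ)) b h
        · rw [nodeSwap_of_unselected hl, nodeSwap_of_unselected hl]
          exact .sub d₁ i (.sub j l h)
      · rw [nodeSwap_of_lt i hj, nodeSwap_of_lt i hj]
        exact .sub d₁ i (.sub j l h)

/-- The only edges that are not mapped to edges by the exchange are those of the stars. -/
theorem map_nodeSwap_mem {f : (hardTree D).edgeSet} (hs : ∀ p, starEdge d d' p ≠ f) :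
    Sym2.map (nodeSwap d d' v) f ∈ (hardTree D).edgeSet := by
  obtain ⟨x, y, h, rfl⟩ := exists_eq_edge f
  exact hardTree_adj.2 (Or.inl (isChild_nodeSwap h hs))

variable (d d' v)

open Classical in
theorem edgeSwap_involutive : Function.Involutive fun f : (hardTree D).edgeSet =>
    if h : Sym2.map (nodeSwap d d' v) f ∈ (hardTree D).edgeSet
    then (⟨Sym2.map (nodeSwap d d' v) f, h⟩ : (hardTree D).edgeSet) else f := by
  intro f
  have hmap : Sym2.map (nodeSwap d d' v) (Sym2.map (nodeSwap d d' v) f) = f := by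
    induction (f : Sym2 (HardNode D D)) with
    | _ x y => simp [nodeSwap_nodeSwap]
  by_cases h : Sym2.map (nodeSwap d d' v) f ∈ (hardTree D).edgeSet
  · simp only [h, dif_pos, hmap, Subtype.coe_prop]
  · simp only [h, dif_neg, not_false_eq_true]

/-- The permutation of the edges of `T_D` induced by `nodeSwap`; the edges whose image is not an edge
are fixed. -/
noncomputable def edgeSwap : Equiv.Perm (hardTree D).edgeSet := (edgeSwap_involutive d d' v).toPerm

variable {d d' v}

theorem edgeSwap_edgeSwap (f : (hardTree D).edgeSet) :
    edgeSwap d d' v (edgeSwap d d' v f) = f :=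
  edgeSwap_involutive d d' v f

theorem edgeSwap_of_mem {f : (hardTree D).edgeSet}
    (h : Sym2.map (nodeSwap d d' v) f ∈ (hardTree D).edgeSet) :
    (edgeSwap d d' v f : Sym2 (HardNode D D)) = Sym2.map (nodeSwap d d' v) f :=
  congrArg Subtype.val (dif_pos h)

theorem edgeSwap_of_notMem {f : (hardTree D).edgeSet}
    (h : Sym2.map (nodeSwap d d' v) f ∉ (hardTree D).edgeSet) : edgeSwap d d' v f = f :=
  dif_neg h

theorem nodeSwap_star_of_none {i : Fin (2 ^ (D - (d : ℕ)))} (hi : v i = none)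
    (b : Fin (2 ^ (D - (d' : ℕ))) ⊕ StarOther d d') :
    nodeSwap d d' v (starParent d d' (i, b)) = starParent d d' (i, b) ∧
      nodeSwap d d' v (starChild d d' (i, b)) = starChild d d' (i, b) := by
  rcases b with k | _ | ⟨j, l⟩ <;>
    simp only [starParent, starChild, hub, nodeSwap_of_none hi, nodeSwap_root, and_self]

theorem nodeSwap_star_congr {v' : Fin (2 ^ (D - (d : ℕ))) → Option (Fin (2 ^ (D - (d' : ℕ))))}
    {i : Fin (2 ^ (D - (d : ℕ)))} (hi : v i = v' i)
    (b : Fin (2 ^ (D - (d' : ℕ))) ⊕ StarOther d d') :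
    nodeSwap d d' v (starParent d d' (i, b)) = nodeSwap d d' v' (starParent d d' (i, b)) ∧
      nodeSwap d d' v (starChild d d' (i, b)) = nodeSwap d d' v' (starChild d d' (i, b)) := by
  rcases hk : v i with _ | k
  · rw [(nodeSwap_star_of_none hk b).1, (nodeSwap_star_of_none hk b).2,
      (nodeSwap_star_of_none (hi ▸ hk) b).1, (nodeSwap_star_of_none (hi ▸ hk) b).2]
    exact ⟨rfl, rfl⟩
  · have hk' : v' i = some k := hi ▸ hk
    rcases b with l | _ | ⟨j, l⟩
    · refine ⟨(nodeSwap_hub hk).trans (nodeSwap_hub hk').symm, ?_⟩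
      by_cases hl : l = k
      · subst hl
        rw [nodeSwap_starChild hk, nodeSwap_starChild hk']
      · have h1 : v i ≠ some l := by rw [hk]; simpa using Ne.symm hl
        have h2 : v' i ≠ some l := by rw [hk']; simpa using Ne.symm hl
        simp only [starChild, nodeSwap_of_unselected h1, nodeSwap_of_unselected h2]
    · exact ⟨nodeSwap_root.trans nodeSwap_root.symm, (nodeSwap_hub hk).trans (nodeSwap_hub hk').symm⟩
    · exact ⟨(nodeSwap_hub hk).trans (nodeSwap_hub hk').symm,
        (nodeSwap_of_lt i j.2 l _).trans (nodeSwap_of_lt i j.2 l _).symm⟩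

/-- The edges of the stars are fixed, because each of them is mapped to itself or to a pair that is not
an edge. Hence the exchange does not change the order in which they arrive. -/
theorem edgeSwap_starEdge (p : StarIndex d d') :
    edgeSwap d d' v (starEdge d d' p) = starEdge d d' p := by
  obtain ⟨i, b⟩ := p
  have hmap : Sym2.map (nodeSwap d d' v) (starEdge d d' (i, b)) =
      s(nodeSwap d d' v (starParent d d' (i, b)), nodeSwap d d' v (starChild d d' (i, b))) := rfl
  by_cases h : Sym2.map (nodeSwap d d' v) (starEdge d d' (i, b)) ∈ (hardTree D).edgeSet
  swap
  · exact edgeSwap_of_notMem h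
  apply Subtype.ext
  rw [edgeSwap_of_mem h, hmap]
  rcases hk : v i with _ | k
  · rw [(nodeSwap_star_of_none hk b).1, (nodeSwap_star_of_none hk b).2]
    rfl
  -- The exchange moves the hub down by one level, so that its edge to a fixed node is destroyed.
  rw [hmap] at h
  have hadj := hardTree_adj.1 h
  rcases b with l | _ | ⟨j, l⟩
  · by_cases hl : l = k
    · subst hl
      rw [nodeSwap_starChild hk]
      simp only [starParent]
      rw [nodeSwap_hub hk]
      exact Sym2.eq_swap
    · have h1 : v i ≠ some l := by rw [hk]; simpa using Ne.symm hl
      simp only [starParent] at hadj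
      rw [nodeSwap_hub hk] at hadj
      simp only [starChild, nodeSwap_of_unselected h1] at hadj
      rcases hadj with hadj | hadj <;> simpa [depth] using hadj.depth_eq
  · simp only [starParent, starChild, nodeSwap_root] at hadj
    rw [nodeSwap_hub hk] at hadj
    rcases hadj with hadj | hadj <;> simpa [depth, starChild] using hadj.depth_eq
  · simp only [starParent] at hadj
    rw [nodeSwap_hub hk] at hadj
    simp only [starChild, nodeSwap_of_lt i j.2] at hadj
    rcases hadj with hadj | hadj <;> simpa [depth] using hadj.depth_eq

end Star

/-! ### The first edges at a level are oriented by fair coins -/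

section Hit

variable {D : ℕ} (d : Fin D) (d' : Fin (d : ℕ))

open Classical in
/-- The child of level `d'` of the `i`-th hub whose edge comes first among the edges of the star, if
the first edge of the star leads to such a child. -/
noncomputable def firstChild (π : ArrivalOrder D) (i : Fin (2 ^ (D - (d : ℕ)))) :
    Option (Fin (2 ^ (D - (d' : ℕ)))) :=
  if h : ∃ k, IsFirst (starEdge d d') π i k then some h.choose else none

variable {d d'}

theorem firstChild_eq_some {π : ArrivalOrder D} {i : Fin (2 ^ (D - (d : ℕ)))}
    {k : Fin (2 ^ (D - (d' : ℕ)))} :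
    firstChild d d' π i = some k ↔ IsFirst (starEdge d d') π i k := by
  rw [firstChild]
  split_ifs with h
  · rw [Option.some.injEq]
    exact ⟨fun hk => hk ▸ h.choose_spec, fun hk => h.choose_spec.unique (starEdge_injective d d') hk⟩
  · exact ⟨fun hk => absurd hk (by simp), fun hk => absurd ⟨k, hk⟩ h⟩

theorem firstChild_eq_none {π : ArrivalOrder D} {i : Fin (2 ^ (D - (d : ℕ)))} :
    firstChild d d' π i = none ↔ ¬ ∃ k, IsFirst (starEdge d d') π i k := by
  simp only [← firstChild_eq_some, Option.eq_none_iff_forall_ne_some, not_exists, ne_eq]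

variable (d d')

/-- The children selected by the bits `ε` for the order `π`. -/
noncomputable def selection (ε : Fin (2 ^ (D - (d : ℕ))) → Bool) (π : ArrivalOrder D)
    (i : Fin (2 ^ (D - (d : ℕ)))) : Option (Fin (2 ^ (D - (d' : ℕ)))) :=
  if ε i then firstChild d d' π i else none

/-- The exchange of each hub selected by the bits `ε` with its first child, performed on the naming and
on the arrival order. -/
noncomputable def exchange (ε : Fin (2 ^ (D - (d : ℕ))) → Bool) (x : Naming D × ArrivalOrder D) :
    Naming D × ArrivalOrder D :=
  ((nodeSwap d d' (selection d d' ε x.2)).trans x.1,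
    x.2.trans (edgeSwap d d' (selection d d' ε x.2)))

variable {d d'}

theorem isFirst_trans_edgeSwap {v : Fin (2 ^ (D - (d : ℕ))) → Option (Fin (2 ^ (D - (d' : ℕ))))}
    {π : ArrivalOrder D} {i : Fin (2 ^ (D - (d : ℕ)))} {k : Fin (2 ^ (D - (d' : ℕ)))} :
    IsFirst (starEdge d d') (π.trans (edgeSwap d d' v)) i k ↔ IsFirst (starEdge d d') π i k := by
  have h : ∀ p, (edgeSwap d d' v).symm (starEdge d d' p) = starEdge d d' p := fun p =>
    (edgeSwap d d' v).symm_apply_eq.2 (edgeSwap_starEdge p).symm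
  simp only [IsFirst, Equiv.symm_trans_apply, h]

theorem firstChild_exchange (ε : Fin (2 ^ (D - (d : ℕ))) → Bool) (x : Naming D × ArrivalOrder D) :
    firstChild d d' (exchange d d' ε x).2 = firstChild d d' x.2 := by
  funext i
  apply Option.ext
  intro k
  rw [firstChild_eq_some, firstChild_eq_some]
  exact isFirst_trans_edgeSwap

theorem exchange_involutive (ε : Fin (2 ^ (D - (d : ℕ))) → Bool) :
    Function.Involutive (exchange d d' ε) := by
  intro x
  have h : selection d d' ε (exchange d d' ε x).2 = selection d d' ε x.2 := by
    funext i
    simp only [selection, firstChild_exchange]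
  rw [exchange, h]
  apply Prod.ext
  · ext y
    simp [exchange, nodeSwap_nodeSwap]
  · exact Equiv.ext fun t => edgeSwap_edgeSwap _

/-- The first edge of the star at the `i`-th hub leads to a child of level `d'` and is oriented
towards the hub. -/
def IsHit (d : Fin D) (d' : Fin (d : ℕ)) (A : OnlineOrienter (Fin (hardSize D)))
    (x : Naming D × ArrivalOrder D) (i : Fin (2 ^ (D - (d : ℕ)))) : Prop :=
  ∃ k, IsFirst (starEdge d d') x.2 i k ∧
    A.run (revealed x.1 x.2) (x.2.symm (starEdge d d' (i, .inl k))) = x.1 (hub d i)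

theorem OnlineOrienter.run_congr {X : Type*} (A : OnlineOrienter X) {k : ℕ} {f g : Fin k → Sym2 X}
    {t : Fin k} (h : ∀ s ≤ t, f s = g s) : A.run f t = A.run g t := by
  have : (List.ofFn f).take t = (List.ofFn g).take t := by
    apply List.ext_getElem
    · simp
    · intro n h1 h2
      simp only [List.length_take, List.length_ofFn, lt_inf_iff] at h1
      simp only [List.getElem_take, List.getElem_ofFn]
      exact h ⟨n, h1.2⟩ h1.1.le
  rw [OnlineOrienter.run, OnlineOrienter.run, this, h t le_rfl]

/-- Naming and arrival order are transformed together, so that the revealed names do not change. -/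
theorem revealed_exchange_of_notMem (ε : Fin (2 ^ (D - (d : ℕ))) → Bool)
    (x : Naming D × ArrivalOrder D) (s) (hs : ∀ p, starEdge d d' p ≠ x.2 s) :
    revealed (exchange d d' ε x).1 (exchange d d' ε x).2 s = revealed x.1 x.2 s := by
  simp only [revealed, exchange, Equiv.trans_apply]
  rw [edgeSwap_of_mem (map_nodeSwap_mem hs), Sym2.map_map]
  congr 1
  funext y
  simp [nodeSwap_nodeSwap]

theorem revealed_exchange_star (ε : Fin (2 ^ (D - (d : ℕ))) → Bool)
    (x : Naming D × ArrivalOrder D) (p : StarIndex d d') :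
    revealed (exchange d d' ε x).1 (exchange d d' ε x).2 (x.2.symm (starEdge d d' p)) =
      s(x.1 (nodeSwap d d' (selection d d' ε x.2) (starParent d d' p)),
        x.1 (nodeSwap d d' (selection d d' ε x.2) (starChild d d' p))) := by
  simp only [revealed, exchange, Equiv.trans_apply, Equiv.apply_symm_apply, edgeSwap_starEdge]
  rfl

/-- Up to the arrival of the first edge at the `i`-th hub, the revealed names depend only on the bits of
the hubs whose first edge arrives earlier. -/
theorem revealed_exchange_congr {ε ε' : Fin (2 ^ (D - (d : ℕ))) → Bool}
    {x : Naming D × ArrivalOrder D} {i : Fin (2 ^ (D - (d : ℕ)))} {k : Fin (2 ^ (D - (d' : ℕ)))}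
    (hk : IsFirst (starEdge d d') x.2 i k)
    (h : ∀ j l, IsFirst (starEdge d d') x.2 j l →
      x.2.symm (starEdge d d' (j, .inl l)) < x.2.symm (starEdge d d' (i, .inl k)) → ε j = ε' j)
    {s} (hs : s ≤ x.2.symm (starEdge d d' (i, .inl k))) :
    revealed (exchange d d' ε x).1 (exchange d d' ε x).2 s =
      revealed (exchange d d' ε' x).1 (exchange d d' ε' x).2 s := by
  by_cases hstar : ∃ p, starEdge d d' p = x.2 s
  swap
  · push Not at hstar
    rw [revealed_exchange_of_notMem ε x s hstar, revealed_exchange_of_notMem ε' x s hstar]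
  obtain ⟨⟨j, b⟩, hp⟩ := hstar
  obtain rfl := (x.2.symm_apply_eq.2 hp)
  rw [revealed_exchange_star, revealed_exchange_star]
  by_cases hj : selection d d' ε x.2 j = selection d d' ε' x.2 j
  · rw [(nodeSwap_star_congr hj b).1, (nodeSwap_star_congr hj b).2]
  -- Otherwise the edge is the first edge at the `i`-th hub, whose endpoints are exchanged or not.
  obtain ⟨l, hl⟩ : ∃ l, IsFirst (starEdge d d') x.2 j l := by
    by_contra hl
    rw [← firstChild_eq_none] at hl
    simp [selection, hl] at hj
  have hle := (hl b).trans hs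
  have heq : x.2.symm (starEdge d d' (j, .inl l)) = x.2.symm (starEdge d d' (i, .inl k)) := by
    refine hle.eq_of_not_lt fun hlt => hj ?_
    simp only [selection, h j l hl hlt]
  have h1 := starEdge_injective d d' (x.2.symm.injective heq)
  simp only [Prod.mk.injEq, Sum.inl.injEq] at h1
  obtain ⟨rfl, rfl⟩ := h1
  have h2 := starEdge_injective d d' (x.2.symm.injective (le_antisymm hs (hl b)))
  obtain rfl : b = Sum.inl l := congrArg Prod.snd h2
  have key : ∀ ε : Fin (2 ^ (D - (d : ℕ))) → Bool,
      s(x.1 (nodeSwap d d' (selection d d' ε x.2) (starParent d d' (j, .inl l))),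
        x.1 (nodeSwap d d' (selection d d' ε x.2) (starChild d d' (j, .inl l)))) =
      s(x.1 (hub d j), x.1 (starChild d d' (j, .inl l))) := by
    intro ε
    rcases hε : ε j
    · have : selection d d' ε x.2 j = none := by simp [selection, hε]
      rw [(nodeSwap_star_of_none this _).1, (nodeSwap_star_of_none this _).2]
      rfl
    · have : selection d d' ε x.2 j = some l := by simp [selection, hε, firstChild_eq_some.2 hl]
      rw [nodeSwap_starChild this]
      simp only [starParent]
      rw [nodeSwap_hub this]
      exact Sym2.eq_swap
  rw [key, key]

/-- Whether a hub is hit flips with its bit, given the bits of the hubs whose first edge arrives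
earlier: the algorithm sees the same names and chooses the same endpoint, but the two endpoints have
exchanged their roles. -/
theorem isHit_exchange_iff_not (A : OnlineOrienter (Fin (hardSize D)))
    {ε ε' : Fin (2 ^ (D - (d : ℕ))) → Bool}
    {x : Naming D × ArrivalOrder D} {i : Fin (2 ^ (D - (d : ℕ)))} {k : Fin (2 ^ (D - (d' : ℕ)))}
    (hk : IsFirst (starEdge d d') x.2 i k) (hi : ε i ≠ ε' i)
    (h : ∀ j l, IsFirst (starEdge d d') x.2 j l →
      x.2.symm (starEdge d d' (j, .inl l)) < x.2.symm (starEdge d d' (i, .inl k)) → ε j = ε' j) :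
    IsHit d d' A (exchange d d' ε x) i ↔ ¬ IsHit d d' A (exchange d d' ε' x) i := by
  wlog hε : ε i = true generalizing ε ε'
  · rw [iff_not_comm]
    refine this hi.symm (fun j l hl hlt => (h j l hl hlt).symm) ?_
    revert hi hε
    cases ε i <;> cases ε' i <;> simp
  have hε' : ε' i = false := by
    rw [hε] at hi
    revert hi
    cases ε' i <;> simp
  have hhit : ∀ ε : Fin (2 ^ (D - (d : ℕ))) → Bool, IsHit d d' A (exchange d d' ε x) i ↔
      A.run (revealed (exchange d d' ε x).1 (exchange d d' ε x).2)
        (x.2.symm (starEdge d d' (i, .inl k))) = (exchange d d' ε x).1 (hub d i) := by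
    intro ε
    have ht : (exchange d d' ε x).2.symm (starEdge d d' (i, .inl k)) =
        x.2.symm (starEdge d d' (i, .inl k)) := by
      simp only [exchange, Equiv.symm_trans_apply]
      rw [(Equiv.symm_apply_eq _).2 (edgeSwap_starEdge _).symm]
    have hk' : IsFirst (starEdge d d') (exchange d d' ε x).2 i k := isFirst_trans_edgeSwap.2 hk
    rw [← ht]
    constructor
    · rintro ⟨l, hl, hA⟩
      rwa [hk'.unique (starEdge_injective d d') hl]
    · exact fun hA => ⟨k, hk', hA⟩
  rw [hhit, hhit, A.run_congr fun s hs => revealed_exchange_congr hk h hs]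
  have hsel : selection d d' ε x.2 i = some k := by
    simp [selection, hε, firstChild_eq_some.2 hk]
  have hsel' : selection d d' ε' x.2 i = none := by simp [selection, hε']
  have hmem := A.orient_mem
    ((List.ofFn (revealed (exchange d d' ε' x).1 (exchange d d' ε' x).2)).take
      (x.2.symm (starEdge d d' (i, .inl k))))
    (revealed (exchange d d' ε' x).1 (exchange d d' ε' x).2 (x.2.symm (starEdge d d' (i, .inl k))))
  rw [← OnlineOrienter.run] at hmem
  generalize A.run (revealed (exchange d d' ε' x).1 (exchange d d' ε' x).2)
    (x.2.symm (starEdge d d' (i, .inl k))) = y at hmem ⊢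
  rw [revealed_exchange_star, (nodeSwap_star_of_none hsel' _).1, (nodeSwap_star_of_none hsel' _).2,
    Sym2.mem_iff] at hmem
  have h1 : (exchange d d' ε x).1 (hub d i) = x.1 (starChild d d' (i, .inl k)) := by
    simp only [exchange, Equiv.trans_apply]
    rw [nodeSwap_hub hsel]
  have h2 : (exchange d d' ε' x).1 (hub d i) = x.1 (hub d i) := by
    simp only [exchange, Equiv.trans_apply]
    rw [hub, nodeSwap_of_none hsel']
  have hne : x.1 (hub d i) ≠ x.1 (starChild d d' (i, .inl k)) :=
    fun he => (isChild_star d d' (i, .inl k)).ne (x.1.injective he)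
  rw [h1, h2]
  simp only [starParent] at hmem
  constructor
  · rintro rfl
    exact hne.symm
  · intro hy
    exact hmem.resolve_left hy

open Classical in
/-- Given the hubs whose first edge leads to a child of level `d'`, each of them is hit independently
with probability `1 / 2`. -/
theorem sum_isHit_le (d : Fin D) (d' : Fin (d : ℕ)) (A : OnlineOrienter (Fin (hardSize D)))
    [Fintype (Naming D × ArrivalOrder D)] :
    ∑ x : Naming D × ArrivalOrder D, ∏ i, (if IsHit d d' A x i then (1 / 2 : ℝ) else 1) ≤
      ∑ x : Naming D × ArrivalOrder D,
        ∏ i, (if ∃ k, IsFirst (starEdge d d') x.2 i k then (3 / 4 : ℝ) else 1) := by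
  refine sum_le_sum_of_average (E := Fin (2 ^ (D - (d : ℕ))) → Bool) (exchange d d')
    (fun ε => (exchange_involutive ε).bijective) _ _ fun x => le_of_eq ?_
  let G : Fin (2 ^ (D - (d : ℕ))) → Prop := fun i => ∃ k, IsFirst (starEdge d d') x.2 i k
  let τ : Fin (2 ^ (D - (d : ℕ))) → ℕ := fun i =>
    if h : G i then x.2.symm (starEdge d d' (i, .inl h.choose)) else 0
  have hτ : ∀ i k, IsFirst (starEdge d d') x.2 i k →
      τ i = x.2.symm (starEdge d d' (i, .inl k)) := by
    intro i k hk
    have hG : G i := ⟨k, hk⟩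
    simp only [τ, dif_pos hG]
    rw [hG.choose_spec.unique (starEdge_injective d d') hk]
  -- The bit vector of the hits, completed by the given bits at the remaining hubs.
  let H : (Fin (2 ^ (D - (d : ℕ))) → Bool) → Fin (2 ^ (D - (d : ℕ))) → Bool := fun ε i =>
    if G i then decide (IsHit d d' A (exchange d d' ε x) i) else ε i
  have hH : H.Bijective := by
    refine bijective_of_triangular (G := G) (τ := τ) H (fun ε i hi => if_neg hi) ?_
    intro ε ε' i hi hne hlt
    obtain ⟨k, hk⟩ := hi
    simp only [H, if_pos (show G i from ⟨k, hk⟩)]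
    rw [ne_eq, decide_eq_decide]
    have := isHit_exchange_iff_not A hk hne fun j l hl hjl =>
      hlt j ⟨l, hl⟩ (by rw [hτ j l hl, hτ i k hk]; exact hjl)
    tauto
  calc ∑ ε, ∏ i, (if IsHit d d' A (exchange d d' ε x) i then (1 / 2 : ℝ) else 1)
      = ∑ ε, ∏ i, (if G i ∧ H ε i = true then (1 / 2 : ℝ) else 1) := by
        refine Finset.sum_congr rfl fun ε _ => Finset.prod_congr rfl fun i _ => if_congr ?_ rfl rfl
        constructor
        · intro h
          have hG : G i := by
            obtain ⟨k, hk, -⟩ := h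
            exact ⟨k, isFirst_trans_edgeSwap.1 hk⟩
          exact ⟨hG, by simp only [H, if_pos hG]; exact decide_eq_true h⟩
        · rintro ⟨hG, h⟩
          simp only [H, if_pos hG] at h
          exact of_decide_eq_true h
    _ = ∑ ε : Fin (2 ^ (D - (d : ℕ))) → Bool, ∏ i, (if G i ∧ ε i = true then (1 / 2 : ℝ) else 1) :=
        hH.sum_comp fun ε => ∏ i, (if G i ∧ ε i = true then (1 / 2 : ℝ) else 1)
    _ = ∏ i, (2 * if G i then (3 / 4 : ℝ) else 1) := by
        rw [sum_bool_prod fun i b => if G i ∧ b = true then (1 / 2 : ℝ) else 1]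
        refine Finset.prod_congr rfl fun i _ => ?_
        by_cases h : G i <;> simp [h] <;> norm_num
    _ = _ := by
        rw [Finset.prod_mul_distrib]
        simp [G]

open Classical in
/-- The number of hits at level `d'` exceeds one eighth of the number of hubs, except with
exponentially small probability. -/
theorem card_few_hits_le (d : Fin D) (d' : Fin (d : ℕ)) (A : OnlineOrienter (Fin (hardSize D)))
    (q : ℕ) (hq : 2 ^ (D - (d : ℕ)) = 8 * q) :
    ({x : Naming D × ArrivalOrder D | {i | IsHit d d' A x i}.ncard ≤ q}.ncard : ℝ) ≤
      (3 / 4) ^ q * Nat.card (Naming D × ArrivalOrder D) := by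
  have hA : Fintype (ArrivalOrder D) := Fintype.ofFinite _
  have hN : Fintype (Naming D) := Fintype.ofFinite _
  have h1 : ∑ x : Naming D × ArrivalOrder D,
      ∏ i, (if ∃ k, IsFirst (starEdge d d') x.2 i k then (3 / 4 : ℝ) else 1) =
      Fintype.card (Naming D) * ∑ π : ArrivalOrder D,
        ∏ i, (if ∃ k, IsFirst (starEdge d d') π i k then (3 / 4 : ℝ) else 1) := by
    rw [Fintype.sum_prod_type, ← nsmul_eq_mul, ← Finset.card_univ, ← Finset.sum_const]
  have h2 := sum_isFirst_le (N := Nat.card (hardTree D).edgeSet) (starEdge d d')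
    (starEdge_injective d d') (card_starOther_le d d')
  have h3 := ((sum_isHit_le d d' A).trans h1.le).trans
    (mul_le_mul_of_nonneg_left h2 (Nat.cast_nonneg _))
  -- Markov's inequality for `(1 / 2) ^ (number of hits)`.
  have h4 : ∀ x : Naming D × ArrivalOrder D,
      (if {i | IsHit d d' A x i}.ncard ≤ q then (1 / 2 : ℝ) ^ q else 0) ≤
        ∏ i, (if IsHit d d' A x i then (1 / 2 : ℝ) else 1) := by
    intro x
    rw [Finset.prod_ite, Finset.prod_const, Finset.prod_const_one, mul_one,
      Set.ncard_eq_toFinset_card', Set.toFinset_ofPred]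
    split_ifs with h
    · exact pow_le_pow_of_le_one (by norm_num) (by norm_num) h
    · positivity
  have h5 := (Finset.sum_le_sum fun x _ => h4 x).trans h3
  have hpow : ((7 : ℝ) / 8) ^ 2 ^ (D - (d : ℕ)) = ((7 / 8) ^ 8) ^ q := by rw [hq, pow_mul]
  rw [← Finset.sum_filter, Finset.sum_const, nsmul_eq_mul, Fintype.card_fin, hpow] at h5
  rw [Set.ncard_eq_toFinset_card', Set.toFinset_ofPred, Nat.card_prod, Nat.card_eq_fintype_card,
    Nat.card_eq_fintype_card]
  push_cast
  have h6 : (0 : ℝ) < (1 / 2) ^ q := by positivity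
  refine le_of_mul_le_mul_right (h5.trans ?_) h6
  have h7 : (((7 : ℝ) / 8) ^ 8) ^ q ≤ (3 / 4) ^ q * (1 / 2) ^ q := by
    rw [← mul_pow]
    exact pow_le_pow_left₀ (by norm_num) (by norm_num) q
  have h8 := mul_le_mul_of_nonneg_left h7
    (Nat.cast_nonneg (α := ℝ) (Fintype.card (Naming D) * Fintype.card (ArrivalOrder D)))
  push_cast at h8
  linarith

end Hit

/-! ### Some hub has a large load -/

section Load

variable {D : ℕ}

/-- Hits of the same hub at different levels come from different edges. -/
theorem ncard_isHit_le_onlineLoad (d : Fin D) (A : OnlineOrienter (Fin (hardSize D)))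
    (x : Naming D × ArrivalOrder D) (i : Fin (2 ^ (D - (d : ℕ)))) :
    {d' : Fin (d : ℕ) | IsHit d d' A x i}.ncard ≤ onlineLoad A x.1 x.2 := by
  refine le_trans ?_ (le_maxInDegree _ (x.1 (hub d i)))
  rw [← Nat.card_coe_set_eq, ← Nat.card_coe_set_eq]
  refine Nat.card_le_card_of_injective
    (fun d' : {d' : Fin (d : ℕ) | IsHit d d' A x i} =>
      (⟨x.2.symm (starEdge d d'.1 (i, .inl d'.2.choose)), d'.2.choose_spec.2⟩ :
        {t | A.run (revealed x.1 x.2) t = x.1 (hub d i)})) ?_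
  rintro ⟨d₁, h₁⟩ ⟨d₂, h₂⟩ h
  have h3 := IsChild.edge_inj (x.2.symm.injective (congrArg Subtype.val h))
  simp only [starChild, HardNode.sub.injEq, heq_eq_eq, true_and] at h3
  exact Subtype.ext h3.1

/-- If every level has more hits than one eighth of the number of hubs, then some hub is hit at one
eighth of the levels. -/
theorem le_onlineLoad_of_many_hits (d : Fin D) (A : OnlineOrienter (Fin (hardSize D)))
    (x : Naming D × ArrivalOrder D) {q : ℕ} (hq : 2 ^ (D - (d : ℕ)) = 8 * q)
    (h : ∀ d' : Fin (d : ℕ), q < {i | IsHit d d' A x i}.ncard) :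
    (d : ℕ) ≤ 8 * onlineLoad A x.1 x.2 := by
  classical
  have hq0 : 0 < q := by
    have : 0 < 2 ^ (D - (d : ℕ)) := by positivity
    omega
  have h1 : ∑ d' : Fin (d : ℕ), q ≤ ∑ d' : Fin (d : ℕ), {i | IsHit d d' A x i}.ncard :=
    Finset.sum_le_sum fun d' _ => (h d').le
  have h2 : ∑ d' : Fin (d : ℕ), {i | IsHit d d' A x i}.ncard =
      ∑ i, {d' : Fin (d : ℕ) | IsHit d d' A x i}.ncard := by
    simp only [Set.ncard_eq_toFinset_card', Set.toFinset_ofPred, Finset.card_filter]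
    exact Finset.sum_comm
  have h3 : ∑ i, {d' : Fin (d : ℕ) | IsHit d d' A x i}.ncard ≤
      ∑ _i : Fin (2 ^ (D - (d : ℕ))), onlineLoad A x.1 x.2 :=
    Finset.sum_le_sum fun i _ => ncard_isHit_le_onlineLoad d A x i
  have h4 := (h1.trans h2.le).trans h3
  simp only [Finset.sum_const, Finset.card_univ, Fintype.card_fin, smul_eq_mul] at h4
  rw [hq] at h4
  exact le_of_mul_le_mul_right (by linarith) hq0

theorem sq_le_two_pow {e : ℕ} (he : 20 ≤ e) : 48 * e + 192 * e ^ 2 ≤ 2 ^ e := by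
  induction e, he using Nat.le_induction with
  | base => norm_num
  | succ e he ih =>
    rw [pow_succ 2]
    nlinarith

theorem nonempty_naming (D : ℕ) : Nonempty (Naming D) := ⟨Finite.equivFin _⟩

theorem nonempty_arrivalOrder (D : ℕ) : Nonempty (ArrivalOrder D) := ⟨(Finite.equivFin _).symm⟩

/-- The bound for deterministic algorithms, which carries all the others: the load is less than
`D / 40` with probability at most `1 / n`. -/
theorem ncard_small_load_le (hD : 1 ≤ D) (A : OnlineOrienter (Fin (hardSize D))) :
    ({x : Naming D × ArrivalOrder D | D ≤ 40 * onlineLoad A x.1 x.2}ᶜ.ncard : ℝ) * hardSize D ≤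
      Nat.card (Naming D × ArrivalOrder D) := by
  -- For `D ≤ 40` the claim only asks for a load of at least `1`.
  rcases le_or_gt D 40 with hD' | hD'
  · have : {x : Naming D × ArrivalOrder D | D ≤ 40 * onlineLoad A x.1 x.2}ᶜ = ∅ := by
      rw [Set.compl_empty_iff, Set.eq_univ_iff_forall]
      intro x
      have : Nonempty (Fin (Nat.card (hardTree D).edgeSet)) :=
        (nonempty_edgeSet hD).map x.2.symm
      have : 1 ≤ onlineLoad A x.1 x.2 := one_le_maxInDegree _
      change D ≤ _
      omega
    rw [this, Set.ncard_empty, Nat.cast_zero, zero_mul]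
    exact Nat.cast_nonneg _
  let d : Fin D := ⟨D / 2, by omega⟩
  have hd : (d : ℕ) = D / 2 := rfl
  set e := D - (d : ℕ) with he
  have hq : 2 ^ (D - (d : ℕ)) = 8 * 2 ^ (e - 3) := by
    rw [show D - (d : ℕ) = 3 + (e - 3) by omega, pow_add]
    norm_num
  set q := 2 ^ (e - 3) with hqdef
  have hsub : {x : Naming D × ArrivalOrder D | D ≤ 40 * onlineLoad A x.1 x.2}ᶜ ⊆
      ⋃ d' : Fin (d : ℕ), {x | {i | IsHit d d' A x i}.ncard ≤ q} := by
    intro x hx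
    by_contra hx'
    simp only [Set.mem_iUnion, Set.mem_ofPred_eq, not_exists, not_le] at hx'
    have := le_onlineLoad_of_many_hits d A x hq hx'
    refine hx ?_
    change D ≤ _
    omega
  have hcard : ({x : Naming D × ArrivalOrder D | D ≤ 40 * onlineLoad A x.1 x.2}ᶜ.ncard : ℝ) ≤
      (d : ℕ) * ((3 / 4) ^ q * Nat.card (Naming D × ArrivalOrder D)) := by
    calc _ ≤ (((⋃ d' : Fin (d : ℕ), {x | {i | IsHit d d' A x i}.ncard ≤ q}).ncard : ℕ) : ℝ) := by
          exact_mod_cast Set.ncard_le_ncard hsub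
      _ ≤ ((∑ d' : Fin (d : ℕ), {x | {i | IsHit d d' A x i}.ncard ≤ q}.ncard : ℕ) : ℝ) := by
          exact_mod_cast Set.ncard_iUnion_le_of_fintype _
      _ ≤ ∑ d' : Fin (d : ℕ), (3 / 4 : ℝ) ^ q * Nat.card (Naming D × ArrivalOrder D) := by
          push_cast
          exact Finset.sum_le_sum fun d' _ => card_few_hits_le d d' A q hq
      _ = _ := by simp
  -- The failure probability `d * (3 / 4) ^ q` is doubly exponentially small in `D`, while the number of
  -- nodes is only `2 ^ O(D ^ 2)`.
  have hnum : ((d : ℕ) : ℝ) * (3 / 4) ^ q * hardSize D ≤ 1 := by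
    have h1 : ((d : ℕ) : ℝ) ≤ 2 ^ D := by
      have : (d : ℕ) ≤ 2 ^ D := d.2.le.trans Nat.lt_two_pow_self.le
      exact_mod_cast this
    have h2 : (hardSize D : ℝ) ≤ 2 ^ (2 * D ^ 2) := by
      rw [pow_mul]
      have := hardSize_le D
      norm_num
      exact_mod_cast this
    have h3 : 3 * (D + 2 * D ^ 2) ≤ q := by
      have h4 := sq_le_two_pow (e := e) (by omega)
      rw [hq] at h4
      have h5 : D ≤ 2 * e := by omega
      have h6 : D ^ 2 ≤ (2 * e) ^ 2 := Nat.pow_le_pow_left h5 2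
      have h7 : (2 * e) ^ 2 = 4 * e ^ 2 := by ring
      omega
    have h4 : ((3 : ℝ) / 4) ^ q ≤ (1 / 2) ^ (D + 2 * D ^ 2) := by
      refine (pow_le_pow_of_le_one (by norm_num) (by norm_num) h3).trans ?_
      rw [pow_mul]
      exact pow_le_pow_left₀ (by norm_num) (by norm_num) _
    calc ((d : ℕ) : ℝ) * (3 / 4) ^ q * hardSize D
        ≤ 2 ^ D * (1 / 2) ^ (D + 2 * D ^ 2) * 2 ^ (2 * D ^ 2) := by gcongr
      _ = 1 := by
        rw [pow_add, one_div, inv_pow, inv_pow]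
        field_simp
  calc _ ≤ ((d : ℕ) * ((3 / 4) ^ q * Nat.card (Naming D × ArrivalOrder D))) * (hardSize D : ℝ) :=
        mul_le_mul_of_nonneg_right hcard (Nat.cast_nonneg _)
    _ = (((d : ℕ) : ℝ) * (3 / 4) ^ q * hardSize D) * Nat.card (Naming D × ArrivalOrder D) := by ring
    _ ≤ 1 * Nat.card (Naming D × ArrivalOrder D) :=
        mul_le_mul_of_nonneg_right hnum (Nat.cast_nonneg _)
    _ = _ := one_mul _

variable {Ω : Type*} [MeasurableSpace Ω] (P : Measure Ω) [IsProbabilityMeasure P]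
  (A : Ω → OnlineOrienter (Fin (hardSize D)))

/-- The bound for randomized algorithms under a uniformly random naming. -/
theorem le_lintegral_unifExp_load (hD : 1 ≤ D) :
    1 - (hardSize D : ℝ≥0∞)⁻¹ ≤ ∫⁻ ω, unifExp (fun x : Naming D × ArrivalOrder D =>
      Set.indicator {x : Naming D × ArrivalOrder D | D ≤ 40 * onlineLoad (A ω) x.1 x.2} 1 x) ∂P := by
  have := nonempty_naming D
  have := nonempty_arrivalOrder D
  calc 1 - (hardSize D : ℝ≥0∞)⁻¹ = ∫⁻ _ω, 1 - (hardSize D : ℝ≥0∞)⁻¹ ∂P := by simp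
    _ ≤ _ := lintegral_mono fun ω =>
      one_sub_inv_le_unifExp_indicator _ _ (ncard_small_load_le hD (A ω))

theorem measurable_onlineLoad {A : Ω → OnlineOrienter (Fin (hardSize D))}
    (hA : ∀ h e, Measurable fun ω => (A ω).orient h e) (ψ : Naming D) (π : ArrivalOrder D) :
    Measurable fun ω => onlineLoad (A ω) ψ π := by
  have h1 : Measurable fun ω => (A ω).run (revealed ψ π) :=
    measurable_pi_lambda _ fun t => hA _ _
  exact (Measurable.of_discrete (f := maxInDegree)).comp h1

/-- A naming that is at least as bad as the average one; by Markov's inequality, the bound on the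
probability also bounds the expected load from below. -/
theorem exists_naming (hD : 1 ≤ D) (hA : ∀ h e, Measurable fun ω => (A ω).orient h e) :
    ∃ ψ : Naming D,
      1 - (hardSize D : ℝ≥0∞)⁻¹ ≤ ∫⁻ ω, unifExp (fun π : ArrivalOrder D =>
        Set.indicator {π : ArrivalOrder D | D ≤ 40 * onlineLoad (A ω) ψ π} 1 π) ∂P ∧
      ENNReal.ofReal (D / 80) ≤
        ∫⁻ ω, unifExp (fun π : ArrivalOrder D => (onlineLoad (A ω) ψ π : ℝ≥0∞)) ∂P := by
  have := nonempty_naming D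
  have h1 := le_lintegral_unifExp_load P A hD
  simp only [unifExp_prod] at h1
  have hmeas : ∀ ψ, Measurable fun ω => unifExp (fun π : ArrivalOrder D =>
      Set.indicator {x : Naming D × ArrivalOrder D | D ≤ 40 * onlineLoad (A ω) x.1 x.2} 1
        (ψ, π) : ArrivalOrder D → ℝ≥0∞) := by
    intro ψ
    have := Fintype.ofFinite (ArrivalOrder D)
    simp only [unifExp_eq_sum, div_eq_mul_inv]
    refine Measurable.mul_const (Finset.measurable_sum _ fun π _ => ?_) _
    exact (Measurable.of_discrete (f := fun L : ℕ => Set.indicator {L : ℕ | D ≤ 40 * L}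
      (1 : ℕ → ℝ≥0∞) L)).comp (measurable_onlineLoad hA ψ π)
  rw [lintegral_unifExp P hmeas] at h1
  obtain ⟨ψ, hψ⟩ := exists_unifExp_le fun ψ : Naming D => ∫⁻ ω, unifExp (fun π : ArrivalOrder D =>
      Set.indicator {x : Naming D × ArrivalOrder D | D ≤ 40 * onlineLoad (A ω) x.1 x.2} 1
        (ψ, π) : ArrivalOrder D → ℝ≥0∞) ∂P
  have h2 := h1.trans hψ
  refine ⟨ψ, h2, ?_⟩
  have hn : (2 : ℝ≥0∞) ≤ hardSize D := by
    have := lt_hardSize D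
    exact_mod_cast (by omega : 2 ≤ hardSize D)
  have hhalf : (2 : ℝ≥0∞)⁻¹ ≤ 1 - (hardSize D : ℝ≥0∞)⁻¹ := by
    rw [← ENNReal.one_sub_inv_two]
    exact tsub_le_tsub_left (ENNReal.inv_le_inv.2 hn) _
  calc ENNReal.ofReal (D / 80) = ENNReal.ofReal (D / 40) * 2⁻¹ := by
        rw [← ENNReal.ofReal_ofNat 2, ← ENNReal.ofReal_inv_of_pos two_pos,
          ← ENNReal.ofReal_mul (by positivity)]
        congr 1
        ring
    _ ≤ ENNReal.ofReal (D / 40) * _ := mul_le_mul_right (hhalf.trans h2) _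
    _ ≤ _ := lintegral_const_mul_le _ _
    _ ≤ _ := by
      refine lintegral_mono fun ω => ?_
      rw [← unifExp_const_mul]
      refine unifExp_mono fun π => ?_
      by_cases hL : D ≤ 40 * onlineLoad (A ω) ψ π
      · rw [Set.indicator_of_mem (by exact hL), Pi.one_apply, mul_one]
        refine ENNReal.ofReal_le_of_le_toReal ?_
        rw [ENNReal.toReal_natCast, div_le_iff₀ (by norm_num), mul_comm]
        exact_mod_cast hL
      · rw [Set.indicator_of_notMem (by exact hL), mul_zero]
        exact zero_le

end Load

/-! ### Unrelated machines -/

section Machines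

open Classical in
/-- The size vector of the job that corresponds to an edge: size `1` on the machines named by the two
endpoints and `⊤` on all others. -/
noncomputable def edgeJob {n m : ℕ} (hnm : n ≤ m) (e : Sym2 (Fin n)) (i : Fin m) : ℝ≥0∞ :=
  if ∃ x ∈ e, Fin.castLE hnm x = i then 1 else ⊤

open Classical in
/-- The orientation algorithm that feeds the jobs of the edges to a scheduler and orients an edge
towards the machine of its job; if that machine is no endpoint, the choice is arbitrary. -/
noncomputable def schedulerOrienter {n m : ℕ} (hnm : n ≤ m) (N : ℕ) (A : OnlineScheduler m) :
    OnlineOrienter (Fin n) where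
  orient h e := if H : ∃ x ∈ e, Fin.castLE hnm x = A N (h.map (edgeJob hnm)) (edgeJob hnm e)
    then H.choose else e.out.1
  orient_mem h e := by
    split_ifs with H
    · exact H.choose_spec.1
    · exact e.out_fst_mem

variable {n m N : ℕ} (hnm : n ≤ m)

theorem one_le_edgeJob (e : Sym2 (Fin n)) (i : Fin m) : 1 ≤ edgeJob hnm e i := by
  rw [edgeJob]
  split_ifs <;> simp

theorem le_makespan (p : Fin N → Fin m → ℝ≥0∞) (σ : Fin N → Fin m) (i : Fin m) :
    (∑ j : Fin N, if σ j = i then p j i else 0) ≤ makespan p σ :=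
  le_iSup (fun i => ∑ j : Fin N, if σ j = i then p j i else 0) i

theorem size_le_makespan (p : Fin N → Fin m → ℝ≥0∞) (σ : Fin N → Fin m) (j : Fin N) :
    p j (σ j) ≤ makespan p σ := by
  refine le_trans ?_ (le_makespan p σ (σ j))
  refine le_trans ?_ (Finset.single_le_sum (fun _ _ => zero_le) (Finset.mem_univ j))
  rw [if_pos rfl]

/-- A scheduler that ever uses a machine outside the edge has infinite makespan; otherwise machine loads
and in-degrees agree. -/
theorem maxInDegree_le_makespan (A : OnlineScheduler m) (f : Fin N → Sym2 (Fin n)) :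
    (maxInDegree ((schedulerOrienter hnm N A).run f) : ℝ≥0∞) ≤
      makespan (fun t => edgeJob hnm (f t)) (A.run fun t => edgeJob hnm (f t)) := by
  classical
  set q := fun t => edgeJob hnm (f t) with hq
  have hrun : ∀ t, A.run q t = A N (((List.ofFn f).take t).map (edgeJob hnm)) (edgeJob hnm (f t)) := by
    intro t
    rw [OnlineScheduler.run, List.map_take, List.map_ofFn]
    rfl
  by_cases htop : ∃ t, q t (A.run q t) = ⊤
  · obtain ⟨t, ht⟩ := htop
    have := size_le_makespan q (A.run q) t
    rw [ht, top_le_iff] at this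
    rw [this]
    exact le_top
  push Not at htop
  have hhead : ∀ t, Fin.castLE hnm ((schedulerOrienter hnm N A).run f t) = A.run q t := by
    intro t
    have H : ∃ x ∈ f t, Fin.castLE hnm x =
        A N (((List.ofFn f).take t).map (edgeJob hnm)) (edgeJob hnm (f t)) := by
      by_contra H
      refine htop t ?_
      rw [hrun]
      exact if_neg H
    rw [hrun, OnlineOrienter.run, schedulerOrienter]
    simp only [dif_pos H]
    exact H.choose_spec.2
  rcases isEmpty_or_nonempty (Fin n) with hn | hn
  · simp [maxInDegree]
  obtain ⟨x, hx⟩ := exists_eq_ciSup_of_finite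
    (f := fun v => {t | (schedulerOrienter hnm N A).run f t = v}.ncard)
  rw [maxInDegree, ← hx]
  refine le_trans ?_ (le_makespan q (A.run q) (Fin.castLE hnm x))
  rw [Set.ncard_eq_toFinset_card', Set.toFinset_ofPred, Finset.card_filter]
  push_cast
  refine Finset.sum_le_sum fun t _ => ?_
  by_cases h : (schedulerOrienter hnm N A).run f t = x
  · rw [if_pos h, if_pos (by rw [← hhead, h])]
    exact one_le_edgeJob hnm _ _
  · rw [if_neg h]
    exact zero_le

/-- For instances that look the same in every order. -/
theorem optMakespan_le_expectedMakespan {Ω : Type*} [MeasurableSpace Ω] (P : Measure Ω)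
    [IsProbabilityMeasure P] (A : Ω → OnlineScheduler m) (p : Fin N → Fin m → ℝ≥0∞)
    (hp : ∀ π : Equiv.Perm (Fin N), p ∘ π = p) : optMakespan p ≤ expectedMakespan P A p := by
  calc optMakespan p = ∫⁻ _ω, optMakespan p ∂P := by simp
    _ ≤ _ := lintegral_mono fun ω => by
      rw [← unifExp_const (α := Equiv.Perm (Fin N)) (optMakespan p)]
      refine unifExp_mono fun π => ?_
      have : (fun t => p (π t)) = p := hp π
      rw [this]
      exact iInf_le _ _

theorem le_competitiveRatio {Ω : Type*} [MeasurableSpace Ω] (P : Measure Ω)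
    (A : Ω → OnlineScheduler m) (p : Fin N → Fin m → ℝ≥0∞)
    (hp : (∀ j i, p j i ≠ 0) ∧ optMakespan p ≠ 0 ∧ optMakespan p ≠ ⊤) :
    expectedMakespan P A p / optMakespan p ≤ competitiveRatio P A :=
  le_iSup_of_le N (le_iSup_of_le p (le_iSup_of_le hp le_rfl))

/-- Witnessed by the instance with a single job of size `1`. -/
theorem one_le_competitiveRatio (hm : 1 ≤ m) {Ω : Type*} [MeasurableSpace Ω] (P : Measure Ω)
    [IsProbabilityMeasure P] (A : Ω → OnlineScheduler m) : 1 ≤ competitiveRatio P A := by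
  let p : Fin 1 → Fin m → ℝ≥0∞ := fun _ _ => 1
  have hspan : ∀ σ, makespan p σ ≤ 1 := fun σ => iSup_le fun i => by
    simp only [Finset.univ_unique, Finset.sum_singleton, p]
    split_ifs <;> simp
  have hopt : optMakespan p = 1 := by
    refine le_antisymm ((iInf_le _ fun _ => ⟨0, hm⟩).trans (hspan _)) (le_iInf fun σ => ?_)
    exact size_le_makespan p σ 0
  refine le_trans ?_
    (le_competitiveRatio P A p ⟨fun _ _ => one_ne_zero, by simp [hopt], by simp [hopt]⟩)
  have := optMakespan_le_expectedMakespan P A p fun _ => rfl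
  rw [hopt] at this
  rwa [hopt, div_one]

/-- On the instance formed by the edges of `T_D`, which has optimal makespan `1`, a scheduler is at
best as good as an algorithm for orienting `T_D`. -/
theorem ofReal_le_competitiveRatio {D : ℕ} (hD : 1 ≤ D) (hm : hardSize D ≤ m) {Ω : Type*}
    [MeasurableSpace Ω] (P : Measure Ω) [IsProbabilityMeasure P] (A : Ω → OnlineScheduler m)
    (hA : ∀ N h q, Measurable fun ω => A ω N h q) :
    ENNReal.ofReal (D / 80) ≤ competitiveRatio P A := by
  classical
  have := nonempty_edgeSet hD
  have hN : 0 < Nat.card (hardTree D).edgeSet := Nat.card_pos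
  obtain ⟨ψ, -, hψ⟩ := exists_naming P
    (fun ω => schedulerOrienter hm (Nat.card (hardTree D).edgeSet) (A ω)) hD (fun h e =>
      (Measurable.of_discrete (f := fun i : Fin m =>
        if H : ∃ x ∈ e, Fin.castLE hm x = i then H.choose else e.out.1)).comp
        (hA _ (h.map (edgeJob hm)) (edgeJob hm e)))
  obtain ⟨π₀⟩ := nonempty_arrivalOrder D
  let p : Fin (Nat.card (hardTree D).edgeSet) → Fin m → ℝ≥0∞ :=
    fun t => edgeJob hm (revealed ψ π₀ t)
  have hopt : optMakespan p ≤ 1 := by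
    obtain ⟨head, hinj, hmem⟩ := exists_orientation D
    refine (iInf_le _ fun t => Fin.castLE hm (ψ (head (π₀ t)))).trans (iSup_le fun i => ?_)
    have hsize : ∀ t, p t (Fin.castLE hm (ψ (head (π₀ t)))) = 1 := fun t =>
      if_pos ⟨_, Sym2.mem_map.2 ⟨_, hmem _, rfl⟩, rfl⟩
    by_cases hi : ∃ t, Fin.castLE hm (ψ (head (π₀ t))) = i
    · obtain ⟨t, rfl⟩ := hi
      rw [Finset.sum_eq_single t, if_pos rfl, hsize]
      · intro s _ hs
        refine if_neg fun h => hs ?_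
        exact π₀.injective (hinj (ψ.injective (Fin.castLE_injective hm h)))
      · exact fun h => absurd (Finset.mem_univ t) h
    · push Not at hi
      rw [Finset.sum_eq_zero fun t _ => if_neg (hi t)]
      exact zero_le
  have hopt0 : optMakespan p ≠ 0 := by
    refine (lt_of_lt_of_le one_pos (le_iInf fun σ => ?_)).ne'
    exact (one_le_edgeJob hm _ _).trans (size_le_makespan p σ ⟨0, hN⟩)
  refine le_trans ?_
    (le_competitiveRatio P A p ⟨fun j i => ?_, hopt0, (hopt.trans_lt ENNReal.one_lt_top).ne⟩)
  swap
  · exact (lt_of_lt_of_le one_pos (one_le_edgeJob hm _ _)).ne'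
  have hexp : ENNReal.ofReal (D / 80) ≤ expectedMakespan P A p := by
    refine hψ.trans (lintegral_mono fun ω => ?_)
    let φ : Equiv.Perm (Fin (Nat.card (hardTree D).edgeSet)) ≃ ArrivalOrder D :=
      Equiv.equivCongr (Equiv.refl _) π₀
    rw [← unifExp_comp_equiv φ]
    refine unifExp_mono fun σ => ?_
    have := maxInDegree_le_makespan hm (A ω) (revealed ψ (φ σ))
    exact this
  calc _ ≤ expectedMakespan P A p := hexp
    _ = expectedMakespan P A p / 1 := (div_one _).symm
    _ ≤ _ := ENNReal.div_le_div_left hopt _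

end Machines

/-! ### The bounds in terms of the number of nodes and of machines -/

theorem sqrt_log_le {m D : ℕ} (hm : m ≤ 4 ^ D ^ 2) : √(Real.log m) ≤ 2 * D := by
  rw [Real.sqrt_le_left (by positivity)]
  rcases Nat.eq_zero_or_pos m with rfl | hpos
  · simp
  calc Real.log m ≤ Real.log (4 ^ D ^ 2) :=
        Real.log_le_log (by exact_mod_cast hpos) (by exact_mod_cast hm)
    _ = D ^ 2 * Real.log 4 := by rw [Real.log_pow]; push_cast; rfl
    _ ≤ D ^ 2 * 4 := by
        have := Real.log_le_sub_one_of_pos (show (0 : ℝ) < 4 by norm_num)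
        exact mul_le_mul_of_nonneg_left (by linarith) (by positivity)
    _ = _ := by ring

theorem exists_hardSize_le_lt {m : ℕ} (hm : 3 ≤ m) :
    ∃ D, 1 ≤ D ∧ hardSize D ≤ m ∧ m < hardSize (D + 1) := by
  have hex : ∃ D, m < hardSize (D + 1) := ⟨m, (Nat.lt_succ_self m).trans (lt_hardSize _)⟩
  have hne : Nat.find hex ≠ 0 := by
    intro h
    have := Nat.find_spec hex
    rw [h, zero_add, hardSize_one] at this
    omega
  refine ⟨Nat.find hex, Nat.one_le_iff_ne_zero.2 hne, ?_, Nat.find_spec hex⟩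
  have := Nat.find_min hex (Nat.sub_one_lt hne)
  rw [Nat.sub_add_cancel (Nat.one_le_iff_ne_zero.2 hne)] at this
  omega

theorem mainTheorem1 :
    ∃ c : ℝ, 0 < c ∧
      (∀ D : ℕ, 1 ≤ D →
        (hardTree D).IsTree ∧
        IsGreatest (Set.range ((hardTree D).dist (HardNode.root D))) D ∧
        hardSize D ≤ 4 ^ (D ^ 2) ∧
        c * √(Real.log (hardSize D)) ≤ D ∧
        IsLeast (orientationLoads (hardTree D)) 1 ∧
        ∀ (Ω : Type*) [MeasurableSpace Ω] (P : Measure Ω) [IsProbabilityMeasure P]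
          (A : Ω → OnlineOrienter (Fin (hardSize D))),
          (∀ h e, Measurable fun ω => (A ω).orient h e) →
          1 - (hardSize D : ℝ≥0∞)⁻¹ ≤
            ∫⁻ ω, unifExp (fun x : Naming D × ArrivalOrder D =>
              Set.indicator {x : Naming D × ArrivalOrder D |
                c * √(Real.log (hardSize D)) ≤ onlineLoad (A ω) x.1 x.2} 1 x) ∂P ∧
          ∃ ψ : Naming D,
            1 - (hardSize D : ℝ≥0∞)⁻¹ ≤
              ∫⁻ ω, unifExp (fun π : ArrivalOrder D =>
                Set.indicator {π : ArrivalOrder D |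
                  c * √(Real.log (hardSize D)) ≤ onlineLoad (A ω) ψ π} 1 π) ∂P ∧
            ENNReal.ofReal (c * √(Real.log (hardSize D))) ≤
              ∫⁻ ω, unifExp (fun π : ArrivalOrder D => (onlineLoad (A ω) ψ π : ℝ≥0∞)) ∂P) ∧
      (∀ m : ℕ, 1 ≤ m →
        ∀ (Ω : Type*) [MeasurableSpace Ω] (P : Measure Ω) [IsProbabilityMeasure P]
          (A : Ω → OnlineScheduler m),
          (∀ N h q, Measurable fun ω => A ω N h q) →
          ENNReal.ofReal (c * √(Real.log m)) ≤ competitiveRatio P A) := by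
  -- By `sqrt_log_le`, `√(log n) ≤ 2 * D` and `√(log m) ≤ 2 * (D + 1) ≤ 4 * D`, so any `c ≤ 1 / 320` is
  -- small enough for the bounds `D / 40` and `D / 80` on the load.
  refine ⟨1 / 1000, by norm_num, fun D hD => ?_, fun m hm Ω _ P _ A hA => ?_⟩
  · have hlog := sqrt_log_le (hardSize_le D)
    have hD0 : (0 : ℝ) ≤ D := Nat.cast_nonneg D
    have hload : ∀ L : ℕ, D ≤ 40 * L → 1 / 1000 * √(Real.log (hardSize D)) ≤ L := by
      intro L hL
      have : (D : ℝ) ≤ 40 * L := by exact_mod_cast hL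
      linarith
    refine ⟨hardTree_isTree D, isGreatest_dist D, hardSize_le D, by linarith,
      isLeast_orientationLoads hD, fun Ω _ P _ A hA => ⟨?_, ?_⟩⟩
    · refine (le_lintegral_unifExp_load P A hD).trans
        (lintegral_mono fun ω => unifExp_mono fun x => ?_)
      exact Set.indicator_le_indicator_of_subset (fun x hx => hload _ hx) (fun _ => zero_le) x
    · obtain ⟨ψ, h1, h2⟩ := exists_naming P A hD hA
      refine ⟨ψ, h1.trans (lintegral_mono fun ω => unifExp_mono fun π => ?_),
        (ENNReal.ofReal_le_ofReal (by linarith)).trans h2⟩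
      exact Set.indicator_le_indicator_of_subset (fun x hx => hload _ hx) (fun _ => zero_le) π
  · -- The smallest tree `T_1` needs three machines.
    rcases lt_or_ge m 3 with hm3 | hm3
    · refine le_trans ?_ (one_le_competitiveRatio hm P A)
      have h1 : √(Real.log m) ≤ 2 * (1 : ℕ) := sqrt_log_le (by norm_num; omega)
      rw [ENNReal.ofReal_le_one]
      norm_num at h1
      linarith
    · obtain ⟨D, hD, hle, hlt⟩ := exists_hardSize_le_lt hm3
      refine le_trans (ENNReal.ofReal_le_ofReal ?_) (ofReal_le_competitiveRatio hD hle P A hA)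
      have h1 := sqrt_log_le (hlt.le.trans (hardSize_le (D + 1)))
      have h2 : (1 : ℝ) ≤ D := by exact_mod_cast hD
      push_cast at h1
      linarith
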